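/- Let $R$ be a noetherian ring, $I$ an ideal of $R$, $M$ a finitely generated $R$-module, $s\ge 0$ and $f\in I^s\setminus I^{s+1}$. Let $G(M)=\bigoplus_{n\ge 0} I^nM/I^{n+1}M$ (and similarly $G(M/fM)$), and let $\bar f\in I^s/I^{s+1}$ be the initial form of $f$. Let $B(R)=\bigoplus_{n\ge0} I^nt^n$ and $B(M)=\bigoplus_{n\ge0} I^nMt^n$ be the Rees algebra and Rees module, $S_I=\mathrm{Proj}\,B(R)$ the blowup of $\mathrm{Spec}\,R$ along $I$, $\mathcal{B}(M)$ the $\mathcal{O}_{S_I}$-module associated with $B(M)$ (and similarly $\mathcal{B}(M/fM)$), and $E_I\subset S_I$ the exceptional divisor, defined by $I\,B(R)$. Let the weak transform $(f)^\#\subset S_I$ be the closed subscheme defined by the homogeneous ideal $ft^sB(R)$, and the strict transform $(f)'\subset (f)^\#$ the smallest closed subscheme of $S_I$ containing $V(fB(R))\setminus E_I$. For $Y=(f)^\#$ or $(f)'$ put $\mathcal{B}(M)_Y=\mathcal{B}(M)\otimes_{\mathcal{O}_{S_I}}\mathcal{O}_Y$. A point $x\in S_I$ is associated with an $\mathcal{O}_{S_I}$-module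 $\mathcal{F}$, written $x\in\mathrm{Ass}(\mathcal{F})$, if the maximal ideal of $\mathcal{O}_{S_I,x}$ is an associated prime of $\mathcal{F}_x$. Then the following two conditions are equivalent: $(*)$ there is an $n_0$ such that the natural epimorphism $G(M)/\bar fG(M)\to G(M/fM)$ is an isomorphism in every degree $n\ge n_0$; $(**)$ $\mathrm{Ass}(\mathcal{B}(M)_{(f)^\#})\cap\mathrm{Supp}(E_I)=\emptyset$. Moreover, $(**)$ holds if and only if the canonical epimorphism $\mathcal{B}(M)_{(f)^\#}\to\mathcal{B}(M/fM)$, from the restriction of $\mathcal{B}(M)$ to the weak transform onto the module $\mathcal{B}(M/fM)$ (the strict transform of the module $M/fM$), is an isomorphism; and $(**)$ implies that the canonical epimorphism $\mathcal{B}(M)_{(f)^\#}\to\mathcal{B}(M)_{(f)'}$ is an isomorphism. -/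

import Mathlib

open Polynomial TensorProduct Pointwise

noncomputable section

namespace KirbySuperficial

universe u v w

/-! ## Associated graded modules -/

section AssociatedGraded

variable {R : Type u} [CommRing R] (I : Ideal R) (M : Type v) [AddCommGroup M] [Module R M]

/-- The component of degree `n` of `G_I(M)`, that is, `I ^ n M / I ^ (n + 1) M`. -/
abbrev Gr (n : ℕ) : Type v :=
  (I ^ n • ⊤ : Submodule R M) ⧸ (I ^ (n + 1) • ⊤ : Submodule R M).submoduleOf (I ^ n • ⊤)

variable {I} {M}

/-- An `R`-linear map sending `I ^ m M` into `I ^ n M'` and `I ^ (m + 1) M` into `I ^ (n + 1) M'`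
induces a map on graded components. -/
def Gr.mapOf {M' : Type w} [AddCommGroup M'] [Module R M'] (g : M →ₗ[R] M') (m n : ℕ)
    (h : ∀ x ∈ (I ^ m • ⊤ : Submodule R M), g x ∈ (I ^ n • ⊤ : Submodule R M'))
    (h' : ∀ x ∈ (I ^ (m + 1) • ⊤ : Submodule R M), g x ∈ (I ^ (n + 1) • ⊤ : Submodule R M')) :
    Gr I M m →ₗ[R] Gr I M' n :=
  Submodule.mapQ _ _ (g.restrict h) (fun x hx => h' x.1 hx)

theorem map_mem_pow_smul_top {M' : Type w} [AddCommGroup M'] [Module R M'] (g : M →ₗ[R] M')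
    (J : Ideal R) (x : M) (hx : x ∈ (J • ⊤ : Submodule R M)) :
    g x ∈ (J • ⊤ : Submodule R M') := by
  have h : (J • ⊤ : Submodule R M).map g ≤ J • ⊤ := by
    rw [Submodule.map_smul'']
    exact Submodule.smul_mono le_rfl le_top
  exact h (Submodule.mem_map_of_mem hx)

/-- The degree `n` component of the map `G_I(M) → G_I(M')` induced by `g : M → M'`. -/
def Gr.map {M' : Type w} [AddCommGroup M'] [Module R M'] (g : M →ₗ[R] M') (n : ℕ) :
    Gr I M n →ₗ[R] Gr I M' n :=
  Gr.mapOf g n n (map_mem_pow_smul_top g _) (map_mem_pow_smul_top g _)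

theorem smul_mem_pow_smul_top {f : R} {s m n : ℕ} (hf : f ∈ I ^ s) (h : m + s = n) (x : M)
    (hx : x ∈ (I ^ m • ⊤ : Submodule R M)) : f • x ∈ (I ^ n • ⊤ : Submodule R M) := by
  rw [← h, add_comm, pow_add, mul_smul]
  exact Submodule.smul_mem_smul hf hx

/-- For `f ∈ I ^ s` with initial form `f̄ ∈ I ^ s / I ^ (s + 1)`, multiplication by `f̄` from
`G_I(M)_m` to `G_I(M)_n`, where `n = m + s`. -/
def Gr.mulInitial {f : R} {s : ℕ} (hf : f ∈ I ^ s) {m n : ℕ} (h : m + s = n) :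
    Gr I M m →ₗ[R] Gr I M n :=
  Gr.mapOf (LinearMap.lsmul R M f) m n
    (smul_mem_pow_smul_top hf h) (smul_mem_pow_smul_top hf (by omega))

variable (M) in
/-- The component of degree `n` of the graded submodule `f̄ G_I(M)` of `G_I(M)`
(it is zero for `n < s`). -/
def Gr.initialSmul {f : R} {s : ℕ} (hf : f ∈ I ^ s) (n : ℕ) : Submodule R (Gr I M n) :=
  ⨆ (m : ℕ) (h : m + s = n), LinearMap.range (Gr.mulInitial (M := M) hf h)

theorem Gr.initialSmul_le_ker {f : R} {s : ℕ} (hf : f ∈ I ^ s) (n : ℕ) :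
    Gr.initialSmul M hf n ≤
      LinearMap.ker (Gr.map (I := I) (f • (⊤ : Submodule R M)).mkQ n) := by
  refine iSup_le fun m => iSup_le fun h => ?_
  rintro _ ⟨y, rfl⟩
  obtain ⟨y, rfl⟩ := Submodule.Quotient.mk_surjective _ y
  rw [LinearMap.mem_ker]
  change Submodule.Quotient.mk _ = _
  rw [Submodule.Quotient.mk_eq_zero]
  change (f • (⊤ : Submodule R M)).mkQ (f • (y : M)) ∈
    (I ^ (n + 1) • ⊤ : Submodule R (M ⧸ f • (⊤ : Submodule R M)))
  have h0 : (f • (⊤ : Submodule R M)).mkQ (f • (y : M)) = 0 := by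
    rw [Submodule.mkQ_apply, Submodule.Quotient.mk_eq_zero]
    exact Submodule.smul_mem_pointwise_smul _ _ _ trivial
  rw [h0]
  exact Submodule.zero_mem _

variable (M) in
/-- The component of degree `n` of the natural epimorphism `G(M) / f̄ G(M) → G(M / fM)`. -/
def Gr.epi {f : R} {s : ℕ} (hf : f ∈ I ^ s) (n : ℕ) :
    (Gr I M n ⧸ Gr.initialSmul M hf n) →ₗ[R] Gr I (QuotSMulTop f M) n :=
  (Gr.initialSmul M hf n).liftQ (Gr.map (f • (⊤ : Submodule R M)).mkQ n)
    (Gr.initialSmul_le_ker hf n)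

end AssociatedGraded

/-! ## Stalks of the sheaf associated with a graded module on `Proj` -/

section HomogeneousLocalization

variable {R : Type u} {A : Type v} [CommRing R] [CommRing A] [Algebra R A]
  (𝒜 : ℕ → Submodule R A) [GradedAlgebra 𝒜]

/-- The local ring of `Proj 𝒜` at `x` (see `AlgebraicGeometry.Proj.stalkIso`). -/
abbrev LocalRing (x : ProjectiveSpectrum 𝒜) : Type v :=
  HomogeneousLocalization.AtPrime 𝒜 x.asHomogeneousIdeal.toIdeal

/-- The stalk at `x` of the ideal sheaf on `Proj 𝒜` defined by a homogeneous ideal `𝔞`: the ideal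
of all degree zero fractions whose numerator is in `𝔞`. -/
def idealStalk (𝔞 : Ideal A) (x : ProjectiveSpectrum 𝒜) : Ideal (LocalRing 𝒜 x) :=
  Ideal.span {z | ∃ c : HomogeneousLocalization.NumDenSameDeg 𝒜
    x.asHomogeneousIdeal.toIdeal.primeCompl,
      (c.num : A) ∈ 𝔞 ∧ z = HomogeneousLocalization.mk c}

variable {N : Type w} [AddCommGroup N] [Module A N] (𝒩 : ℕ → AddSubgroup N)
  [SetLike.GradedSMul 𝒜 𝒩]

/-- The stalk at `x` of the sheaf of modules `Ñ` on `Proj 𝒜` associated with the graded module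
`N = ⨁ 𝒩 n`: the degree zero part `N_(x) = {n / a | n ∈ 𝒩 d, a ∈ 𝒜 d, a ∉ x}` of the
localization of `N` at `x`. -/
def sheafStalkAux (x : ProjectiveSpectrum 𝒜) :
    AddSubgroup (LocalizedModule x.asHomogeneousIdeal.toIdeal.primeCompl N) where
  carrier := {z | ∃ (d : ℕ) (n : N) (a : x.asHomogeneousIdeal.toIdeal.primeCompl),
    n ∈ 𝒩 d ∧ (a : A) ∈ 𝒜 d ∧ z = LocalizedModule.mk n a}
  zero_mem' := ⟨0, 0, 1, zero_mem _, SetLike.GradedOne.one_mem, (LocalizedModule.zero_mk 1).symm⟩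
  neg_mem' := by
    rintro _ ⟨d, n, a, hn, ha, rfl⟩
    exact ⟨d, -n, a, neg_mem hn, ha, LocalizedModule.mk_neg.symm⟩
  add_mem' := by
    rintro _ _ ⟨d, n, a, hn, ha, rfl⟩ ⟨e, m, b, hm, hb, rfl⟩
    refine ⟨d + e, b • n + a • m, a * b, add_mem ?_ ?_, SetLike.mul_mem_graded ha hb,
      LocalizedModule.mk_add_mk⟩
    · have := SetLike.GradedSMul.smul_mem hb hn
      rwa [vadd_eq_add, add_comm] at this
    · exact SetLike.GradedSMul.smul_mem ha hm

/-- The stalk `N_(x)` at `x` of the sheaf of modules `Ñ` on `Proj 𝒜`, as a type. -/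
def SheafStalk (x : ProjectiveSpectrum 𝒜) : Type (max v w) := sheafStalkAux 𝒜 𝒩 x

instance SheafStalk.instAddCommGroup (x : ProjectiveSpectrum 𝒜) :
    AddCommGroup (SheafStalk 𝒜 𝒩 x) :=
  inferInstanceAs (AddCommGroup (sheafStalkAux 𝒜 𝒩 x))

/-- The inclusion of the degree zero part `N_(x)` into the localization of `N` at `x`. -/
def SheafStalk.val {x : ProjectiveSpectrum 𝒜} (z : SheafStalk 𝒜 𝒩 x) :
    LocalizedModule x.asHomogeneousIdeal.toIdeal.primeCompl N := Subtype.val z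

theorem SheafStalk.val_injective (x : ProjectiveSpectrum 𝒜) :
    Function.Injective (SheafStalk.val 𝒜 𝒩 (x := x)) := Subtype.val_injective

theorem smul_val_mem_sheafStalkAux (x : ProjectiveSpectrum 𝒜) (r : LocalRing 𝒜 x)
    (z : SheafStalk 𝒜 𝒩 x) : r.val • z.val ∈ sheafStalkAux 𝒜 𝒩 x := by
  obtain ⟨c, rfl⟩ := HomogeneousLocalization.mk_surjective r
  obtain ⟨_, d, n, a, hn, ha, rfl⟩ := z
  refine ⟨c.deg + d, (c.num : A) • n, ⟨c.den, c.den_mem⟩ * a,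
    SetLike.GradedSMul.smul_mem c.num.2 hn, SetLike.mul_mem_graded c.den.2 ha, ?_⟩
  rw [HomogeneousLocalization.val_mk]
  exact LocalizedModule.mk_smul_mk _ _ _ _

/-- The stalk `N_(x)` is a module over the local ring of `Proj 𝒜` at `x`. -/
instance SheafStalk.instModule (x : ProjectiveSpectrum 𝒜) :
    Module (LocalRing 𝒜 x) (SheafStalk 𝒜 𝒩 x) where
  smul r z := ⟨r.val • z.val, smul_val_mem_sheafStalkAux 𝒜 𝒩 x r z⟩
  one_smul z := SheafStalk.val_injective 𝒜 𝒩 x (by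
    change (1 : LocalRing 𝒜 x).val • z.val = z.val
    rw [HomogeneousLocalization.val_one, one_smul])
  mul_smul r t z := SheafStalk.val_injective 𝒜 𝒩 x (by
    change (r * t).val • z.val = r.val • t.val • z.val
    rw [HomogeneousLocalization.val_mul, mul_smul])
  smul_zero r := SheafStalk.val_injective 𝒜 𝒩 x (smul_zero r.val)
  smul_add r z t := SheafStalk.val_injective 𝒜 𝒩 x (smul_add r.val _ _)
  add_smul r t z := SheafStalk.val_injective 𝒜 𝒩 x (by
    change (r + t).val • z.val = r.val • z.val + t.val • z.val
    rw [HomogeneousLocalization.val_add, add_smul])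
  zero_smul z := SheafStalk.val_injective 𝒜 𝒩 x (by
    change (0 : LocalRing 𝒜 x).val • z.val = 0
    rw [HomogeneousLocalization.val_zero, zero_smul])

theorem SheafStalk.val_smul (x : ProjectiveSpectrum 𝒜) (r : LocalRing 𝒜 x)
    (z : SheafStalk 𝒜 𝒩 x) : (r • z).val = r.val • z.val := rfl

variable {N' : Type*} [AddCommGroup N'] [Module A N'] (𝒩' : ℕ → AddSubgroup N')
  [SetLike.GradedSMul 𝒜 𝒩']

/-- The map of stalks `N_(x) → N'_(x)`, `n / a ↦ g n / a`, induced by a homomorphism of graded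
modules `g : N → N'` of degree zero. -/
def SheafStalk.map (g : N →ₗ[A] N') (hg : ∀ d, ∀ n ∈ 𝒩 d, g n ∈ 𝒩' d)
    (x : ProjectiveSpectrum 𝒜) :
    SheafStalk 𝒜 𝒩 x →ₗ[LocalRing 𝒜 x] SheafStalk 𝒜 𝒩' x where
  toFun z := ⟨LocalizedModule.map x.asHomogeneousIdeal.toIdeal.primeCompl g z.val, by
    obtain ⟨_, d, n, a, hn, ha, rfl⟩ := z
    exact ⟨d, g n, a, hg d n hn, ha, LocalizedModule.map_mk _ _ _ _⟩⟩
  map_add' z t := SheafStalk.val_injective 𝒜 𝒩' x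
    (map_add (LocalizedModule.map x.asHomogeneousIdeal.toIdeal.primeCompl g) z.val t.val)
  map_smul' r z := SheafStalk.val_injective 𝒜 𝒩' x
    (map_smul (LocalizedModule.map x.asHomogeneousIdeal.toIdeal.primeCompl g) r.val z.val)

/-- The points of `Proj 𝒜` associated with a sheaf of modules with stalks `F x`: those `x` for
which the maximal ideal of the local ring at `x` is an associated prime of `F x`. -/
def associatedPoints (F : ProjectiveSpectrum 𝒜 → Type*) [∀ x, AddCommGroup (F x)]
    [∀ x, Module (LocalRing 𝒜 x) (F x)] : Set (ProjectiveSpectrum 𝒜) :=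
  {x | IsLocalRing.maximalIdeal (LocalRing 𝒜 x) ∈ associatedPrimes (LocalRing 𝒜 x) (F x)}

end HomogeneousLocalization

/-! ## The blowup -/

section Rees

variable {R : Type u} [CommRing R] (I : Ideal R)

/-- The homogeneous component `I ^ n t ^ n` of the Rees algebra `B(R) = R[It]`. -/
def reesGrading (n : ℕ) : Submodule R (reesAlgebra I) where
  carrier := {p | ∀ m, m ≠ n → (p : R[X]).coeff m = 0}
  zero_mem' := by intro m _; simp
  add_mem' := by
    intro p q hp hq m hm
    simp [hp m hm, hq m hm]
  smul_mem' := by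
    intro r p hp m hm
    simp [hp m hm]

variable {I} in
/-- The element `r t ^ n` of the Rees algebra, for `r ∈ I ^ n`. -/
def reesMonomial {n : ℕ} {r : R} (hr : r ∈ I ^ n) : reesAlgebra I :=
  ⟨monomial n r, reesAlgebra.monomial_mem.2 hr⟩

theorem reesMonomial_mem {n : ℕ} {r : R} (hr : r ∈ I ^ n) : reesMonomial hr ∈ reesGrading I n :=
  fun _ hm => coeff_monomial_of_ne _ hm

theorem algebraMap_mem_reesGrading (r : R) :
    algebraMap R (reesAlgebra I) r ∈ reesGrading I 0 := fun m hm => by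
  change (C r : R[X]).coeff m = 0
  rw [coeff_C, if_neg hm]

theorem coeff_eq_zero_of_mem {n m : ℕ} {p : reesAlgebra I} (hp : p ∈ reesGrading I n)
    (hm : m ≠ n) : (p : R[X]).coeff m = 0 := hp m hm

instance reesGrading.instGradedMonoid : SetLike.GradedMonoid (reesGrading I) where
  one_mem := by
    intro m hm
    change (1 : R[X]).coeff m = 0
    rw [coeff_one, if_neg hm]
  mul_mem := by
    intro i j p q hp hq m hm
    change ((p : R[X]) * (q : R[X])).coeff m = 0
    rw [coeff_mul]
    refine Finset.sum_eq_zero fun y hy => ?_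
    replace hy := Finset.HasAntidiagonal.mem_antidiagonal.1 hy
    by_cases h : y.1 = i
    · rw [coeff_eq_zero_of_mem I hq (by omega), mul_zero]
    · rw [coeff_eq_zero_of_mem I hp h, zero_mul]

theorem coeff_coeAddMonoidHom (z : DirectSum ℕ fun n => reesGrading I n) (n : ℕ) :
    ((DirectSum.coeAddMonoidHom (reesGrading I) z : reesAlgebra I) : R[X]).coeff n =
      ((z n : reesAlgebra I) : R[X]).coeff n := by
  induction z using DirectSum.induction_on with
  | zero => simp
  | of i y =>
    rw [DirectSum.coeAddMonoidHom_of]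
    by_cases h : n = i
    · subst h
      rw [DirectSum.of_eq_same]
    · rw [DirectSum.of_eq_of_ne _ _ _ h, coeff_eq_zero_of_mem I y.2 h]
      simp
  | add y z hy hz => simp [hy, hz]

instance reesGrading.instGradedAlgebra : GradedAlgebra (reesGrading I) where
  decompose' p := ∑ n ∈ (p : R[X]).support,
    DirectSum.of (fun n => reesGrading I n) n ⟨reesMonomial (p.2 n), reesMonomial_mem I (p.2 n)⟩
  left_inv p := by
    apply Subtype.ext
    rw [map_sum]
    simp only [DirectSum.coeAddMonoidHom_of]
    rw [AddSubmonoidClass.coe_finsetSum]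
    exact (p : R[X]).as_sum_support.symm
  right_inv z := by
    have key : ∀ p : reesAlgebra I, DirectSum.coeAddMonoidHom (reesGrading I)
        (∑ n ∈ (p : R[X]).support, DirectSum.of (fun n => reesGrading I n) n
          ⟨reesMonomial (p.2 n), reesMonomial_mem I (p.2 n)⟩) = p := by
      intro p
      apply Subtype.ext
      rw [map_sum]
      simp only [DirectSum.coeAddMonoidHom_of]
      rw [AddSubmonoidClass.coe_finsetSum]
      exact (p : R[X]).as_sum_support.symm
    have inj : Function.Injective (DirectSum.coeAddMonoidHom (reesGrading I)) := by
      intro y z h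
      refine DFinsupp.ext fun n => Subtype.ext (Subtype.ext (Polynomial.ext fun m => ?_))
      by_cases hm : m = n
      · subst hm
        have h1 := coeff_coeAddMonoidHom I y m
        rw [h, coeff_coeAddMonoidHom] at h1
        exact h1.symm
      · rw [coeff_eq_zero_of_mem I (y n).2 hm, coeff_eq_zero_of_mem I (z n).2 hm]
    exact inj (key _)

/-- The underlying space of the blowup `S_I = Proj B(R)` of `Spec R` along `I`. -/
abbrev Blowup : Type u := ProjectiveSpectrum (reesGrading I)

/-- `Supp(E_I)`: the support of the exceptional divisor, the closed subscheme of `S_I` defined by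
the homogeneous ideal `I B(R)`. -/
def exceptionalSupport : Set (Blowup I) :=
  ProjectiveSpectrum.zeroLocus (reesGrading I) (I.map (algebraMap R (reesAlgebra I)))

/-- The homogeneous ideal `f B(R)` defining the total transform `(f)^*`. -/
def totalTransform (f : R) : Ideal (reesAlgebra I) :=
  Ideal.span {algebraMap R (reesAlgebra I) f}

variable {I} in
/-- The homogeneous ideal `f t ^ s B(R)` defining the weak transform `(f)^#` of `f ∈ I ^ s`. -/
def weakTransform {f : R} {s : ℕ} (hf : f ∈ I ^ s) : Ideal (reesAlgebra I) :=
  Ideal.span {reesMonomial hf}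

/-- The homogeneous ideal defining the strict transform `(f)'`, the smallest closed subscheme of
`S_I` containing the complement of `E_I` in the total transform `(f)^*`. Closed subschemes of `S_I`
are defined by homogeneous ideals of `B(R)`, so this is the largest homogeneous ideal whose ideal
sheaf is contained in that of `(f)^*` at every point outside `E_I`. -/
def strictTransform (f : R) : Ideal (reesAlgebra I) :=
  (sSup {𝔞 : HomogeneousIdeal (reesGrading I) | ∀ y ∉ exceptionalSupport I,
    idealStalk (reesGrading I) 𝔞.toIdeal y ≤
      idealStalk (reesGrading I) (totalTransform I f) y}).toIdeal

variable {I} in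
/-- The strict transform is contained in the weak transform. -/
theorem weakTransform_le_strictTransform {f : R} {s : ℕ} (hf : f ∈ I ^ s) :
    weakTransform hf ≤ strictTransform I f := by
  have hom : (weakTransform hf).IsHomogeneous (reesGrading I) := by
    apply Ideal.homogeneous_span
    rintro x hx
    rw [Set.mem_singleton_iff] at hx
    subst hx
    exact ⟨s, reesMonomial_mem I hf⟩
  have h : (⟨weakTransform hf, hom⟩ : HomogeneousIdeal (reesGrading I)) ≤
      sSup {𝔞 : HomogeneousIdeal (reesGrading I) | ∀ y ∉ exceptionalSupport I,
        idealStalk (reesGrading I) 𝔞.toIdeal y ≤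
          idealStalk (reesGrading I) (totalTransform I f) y} := by
    apply le_sSup
    intro y hy
    have hi : ∃ i ∈ I, algebraMap R (reesAlgebra I) i ∉ y.asHomogeneousIdeal.toIdeal := by
      by_contra! hcon
      apply hy
      change (I.map (algebraMap R (reesAlgebra I)) : Set (reesAlgebra I)) ⊆
        (y.asHomogeneousIdeal.toIdeal : Set (reesAlgebra I))
      exact Ideal.map_le_iff_le_comap.2 hcon
    obtain ⟨i, hiI, hiy⟩ := hi
    refine Ideal.span_le.2 ?_
    rintro _ ⟨c, hc, rfl⟩
    obtain ⟨r, hr⟩ := Ideal.mem_span_singleton'.1 (show (c.num : reesAlgebra I) ∈ weakTransform hf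
      from hc)
    have hb : algebraMap R (reesAlgebra I) (i ^ s) ∈ reesGrading I 0 :=
      algebraMap_mem_reesGrading I _
    refine Ideal.subset_span ⟨⟨c.deg,
      ⟨algebraMap R (reesAlgebra I) (i ^ s) * c.num, ?_⟩,
      ⟨algebraMap R (reesAlgebra I) (i ^ s) * c.den, ?_⟩, ?_⟩, ?_, ?_⟩
    · simpa using SetLike.mul_mem_graded hb c.num.2
    · simpa using SetLike.mul_mem_graded hb c.den.2
    · refine mul_mem ?_ c.den_mem
      rw [map_pow]
      exact pow_mem (S := y.asHomogeneousIdeal.toIdeal.primeCompl) hiy s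
    · refine Ideal.mem_span_singleton'.2 ⟨r * reesMonomial (Ideal.pow_mem_pow hiI s), ?_⟩
      change _ = algebraMap R (reesAlgebra I) (i ^ s) * c.num
      rw [← hr]
      have : reesMonomial (Ideal.pow_mem_pow hiI s) * algebraMap R (reesAlgebra I) f =
          algebraMap R (reesAlgebra I) (i ^ s) * reesMonomial hf := by
        apply Subtype.ext
        change monomial s (i ^ s) * (C f : R[X]) = C (i ^ s) * monomial s f
        rw [monomial_mul_C, C_mul_monomial]
      rw [mul_assoc, this]
      ring
    · apply HomogeneousLocalization.val_injective
      rw [HomogeneousLocalization.val_mk, HomogeneousLocalization.val_mk,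
        Localization.mk_eq_mk_iff, Localization.r_iff_exists]
      refine ⟨1, ?_⟩
      simp only [OneMemClass.coe_one, one_mul]
      ring
  exact h

variable (M : Type v) [AddCommGroup M] [Module R M]

/-- The Rees module `B(M) = ⨁ I ^ n M t ^ n`, as a submodule of `M[t]`. -/
def ReesModule : Type v := (I.stableFiltration (⊤ : Submodule R M)).submodule

instance ReesModule.instAddCommGroup : AddCommGroup (ReesModule I M) :=
  inferInstanceAs (AddCommGroup (I.stableFiltration (⊤ : Submodule R M)).submodule)

instance ReesModule.instModule : Module (reesAlgebra I) (ReesModule I M) :=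
  inferInstanceAs (Module (reesAlgebra I) (I.stableFiltration (⊤ : Submodule R M)).submodule)

/-- The homogeneous component `I ^ n M t ^ n` of `B(M)`. -/
def reesModuleGrading (n : ℕ) : AddSubgroup (ReesModule I M) where
  carrier := {p | ∀ m, m ≠ n → p.1.coeff m = 0}
  zero_mem' := fun _ _ => rfl
  add_mem' := by
    intro p q hp hq m hm
    change p.1.coeff m + q.1.coeff m = 0
    rw [hp m hm, hq m hm, add_zero]
  neg_mem' := by
    intro p hp m hm
    change -p.1.coeff m = 0
    rw [hp m hm, neg_zero]

instance reesModuleGrading.instGradedSMul :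
    SetLike.GradedSMul (reesGrading I) (reesModuleGrading I M) where
  smul_mem := by
    intro i j p q hp hq m hm
    change ((p : R[X]) • q.1).coeff m = 0
    rw [PolynomialModule.smul_apply]
    refine Finset.sum_eq_zero fun y hy => ?_
    replace hy := Finset.HasAntidiagonal.mem_antidiagonal.1 hy
    rw [vadd_eq_add] at hm
    by_cases h : y.1 = i
    · rw [hq y.2 (by omega), smul_zero]
    · rw [hp y.1 h, zero_smul]

variable {M}

/-- The homomorphism of graded modules `B(M) → B(M')` induced by `g : M → M'`. -/
def ReesModule.map {M' : Type w} [AddCommGroup M'] [Module R M'] (g : M →ₗ[R] M') :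
    ReesModule I M →ₗ[reesAlgebra I] ReesModule I M' where
  toFun p := ⟨PolynomialModule.map R g p.1, fun n => by
    exact map_mem_pow_smul_top g (I ^ n) _ (p.2 n)⟩
  map_add' p q := Subtype.ext (map_add _ _ _)
  map_smul' r p := Subtype.ext (by
    change PolynomialModule.map R g ((r : R[X]) • p.1) = (r : R[X]) • PolynomialModule.map R g p.1
    rw [PolynomialModule.map_smul, Algebra.algebraMap_self, Polynomial.map_id])

theorem ReesModule.map_mem {M' : Type w} [AddCommGroup M'] [Module R M'] (g : M →ₗ[R] M') (d : ℕ)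
    (p : ReesModule I M) (hp : p ∈ reesModuleGrading I M d) :
    ReesModule.map I g p ∈ reesModuleGrading I M' d := fun m hm => by
  change g (p.1.coeff m) = 0
  rw [hp m hm, map_zero]

variable (M)

/-- The stalk at `x` of the sheaf `𝓑(M)` on `S_I` associated with the graded module `B(M)`. -/
abbrev SheafB (x : Blowup I) : Type (max u v) :=
  SheafStalk (reesGrading I) (reesModuleGrading I M) x

/-- The stalk at `x` of the restriction `𝓑(M) ⊗ 𝒪_Y` of `𝓑(M)` to the closed subscheme `Y` of `S_I`
defined by the homogeneous ideal `𝔞`. -/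
def RestrictB (𝔞 : Ideal (reesAlgebra I)) (x : Blowup I) : Type (max u v) :=
  SheafB I M x ⊗[LocalRing (reesGrading I) x]
    (LocalRing (reesGrading I) x ⧸ idealStalk (reesGrading I) 𝔞 x)

instance RestrictB.instAddCommGroup (𝔞 : Ideal (reesAlgebra I)) (x : Blowup I) :
    AddCommGroup (RestrictB I M 𝔞 x) :=
  inferInstanceAs (AddCommGroup (SheafB I M x ⊗[LocalRing (reesGrading I) x]
    (LocalRing (reesGrading I) x ⧸ idealStalk (reesGrading I) 𝔞 x)))

instance RestrictB.instModule (𝔞 : Ideal (reesAlgebra I)) (x : Blowup I) :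
    Module (LocalRing (reesGrading I) x) (RestrictB I M 𝔞 x) :=
  inferInstanceAs (Module (LocalRing (reesGrading I) x)
    (SheafB I M x ⊗[LocalRing (reesGrading I) x]
      (LocalRing (reesGrading I) x ⧸ idealStalk (reesGrading I) 𝔞 x)))

variable {I}

theorem idealStalk_mono {𝔞 𝔟 : Ideal (reesAlgebra I)} (h : 𝔞 ≤ 𝔟) (x : Blowup I) :
    idealStalk (reesGrading I) 𝔞 x ≤ idealStalk (reesGrading I) 𝔟 x :=
  Ideal.span_mono (by rintro _ ⟨c, hc, rfl⟩; exact ⟨c, h hc, rfl⟩)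

/-- The stalk at `x` of the canonical epimorphism `𝓑(M) ⊗ 𝒪_{(f)^#} → 𝓑(M) ⊗ 𝒪_{(f)'}` between the
restrictions of `𝓑(M)` to the weak and to the strict transform. -/
def weakToStrict {f : R} {s : ℕ} (hf : f ∈ I ^ s) (x : Blowup I) :
    RestrictB I M (weakTransform hf) x →ₗ[LocalRing (reesGrading I) x]
      RestrictB I M (strictTransform I f) x :=
  LinearMap.lTensor (SheafB I M x) (Submodule.factor
    (idealStalk_mono (weakTransform_le_strictTransform hf) x))

/-- The map of stalks `𝓑(M)_x → 𝓑(M / fM)_x`. -/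
def sheafBToQuot (f : R) (x : Blowup I) :
    SheafB I M x →ₗ[LocalRing (reesGrading I) x] SheafB I (QuotSMulTop f M) x :=
  SheafStalk.map (reesGrading I) (reesModuleGrading I M)
    (reesModuleGrading I (QuotSMulTop f M))
    (ReesModule.map I (f • (⊤ : Submodule R M)).mkQ) (ReesModule.map_mem I _) x

theorem reesMonomial_smul_eq_zero {f : R} {s : ℕ} (hf : f ∈ I ^ s)
    (p : ReesModule I (QuotSMulTop f M)) : reesMonomial hf • p = 0 := by
  apply Subtype.ext
  apply PolynomialModule.ext
  refine Finsupp.ext fun n => ?_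
  change ((monomial s f : R[X]) • p.1).coeff n = 0
  rw [PolynomialModule.monomial_smul_apply]
  split_ifs
  · obtain ⟨m, hm⟩ := Submodule.Quotient.mk_surjective _ (p.1.coeff (n - s))
    rw [← hm, ← Submodule.Quotient.mk_smul, Submodule.Quotient.mk_eq_zero]
    exact Submodule.smul_mem_pointwise_smul _ _ _ trivial
  · rfl

theorem weak_smul_le_ker {f : R} {s : ℕ} (hf : f ∈ I ^ s) (x : Blowup I) :
    idealStalk (reesGrading I) (weakTransform hf) x • (⊤ : Submodule _ (SheafB I M x)) ≤
      LinearMap.ker (sheafBToQuot M f x) := by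
  have key : idealStalk (reesGrading I) (weakTransform hf) x ≤
      Module.annihilator (LocalRing (reesGrading I) x) (SheafB I (QuotSMulTop f M) x) := by
    refine Ideal.span_le.2 ?_
    rintro _ ⟨c, hc, rfl⟩
    rw [SetLike.mem_coe, Module.mem_annihilator]
    intro z
    obtain ⟨d, n, a, -, -, hz⟩ : ∃ (d : ℕ) (n : ReesModule I (QuotSMulTop f M))
        (a : x.asHomogeneousIdeal.toIdeal.primeCompl),
        n ∈ reesModuleGrading I (QuotSMulTop f M) d ∧ (a : reesAlgebra I) ∈ reesGrading I d ∧
          z.val = LocalizedModule.mk n a := z.2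
    apply SheafStalk.val_injective
    rw [SheafStalk.val_smul, HomogeneousLocalization.val_mk, hz]
    refine (LocalizedModule.mk_smul_mk _ _ _ _).trans ?_
    obtain ⟨r, hr⟩ := Ideal.mem_span_singleton'.1 (show (c.num : reesAlgebra I) ∈ weakTransform hf
      from hc)
    rw [← hr, mul_smul, reesMonomial_smul_eq_zero, smul_zero, LocalizedModule.zero_mk]
    rfl
  refine Submodule.smul_le.2 fun r hr z _ => ?_
  rw [LinearMap.mem_ker, map_smul]
  exact Module.mem_annihilator.1 (key hr) _

/-- The stalk at `x` of the canonical epimorphism `𝓑(M) ⊗ 𝒪_{(f)^#} → 𝓑(M / fM)` from the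
restriction of `𝓑(M)` to the weak transform onto the strict transform of the module `M / fM`. -/
def weakToQuot {f : R} {s : ℕ} (hf : f ∈ I ^ s) (x : Blowup I) :
    RestrictB I M (weakTransform hf) x →ₗ[LocalRing (reesGrading I) x]
      SheafB I (QuotSMulTop f M) x :=
  (Submodule.liftQ _ (sheafBToQuot M f x) (weak_smul_le_ker M hf x)) ∘ₗ
    (tensorQuotEquivQuotSMul (SheafB I M x)
      (idealStalk (reesGrading I) (weakTransform hf) x)).toLinearMap

end Rees

end KirbySuperficial

end

noncomputable section

namespace KirbySuperficial

universe u v w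

/-! ## Homogeneous elements of the Rees algebra and of the Rees module -/

section Monomials

variable {R : Type u} [CommRing R] {I : Ideal R} {M : Type v} [AddCommGroup M] [Module R M]

/-! All conditions are compared with one statement about submodules of M, `IsStableInter`: I^n M ∩
fM = f I^(n-s) M for all large n. The kernel of G(M) → G(M/fM) in degree n is the image of I^n M ∩
fM, so condition (*) says that I^n M ∩ fM ⊆ f I^(n-s) M + I^(n+1) M for large n. Iterating this and
using Artin–Rees removes the error term (`exists_bijective_epi_iff`).

Stability makes B(M)/ft^sB(M) → B(M/fM) injective in large degrees, hence an isomorphism of sheaves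
(`IsStableInter.bijective_weakToQuot`). On 𝓑(M/fM) a local equation of E_I acts injectively, so no
point of E_I is associated; this is (**).

Conversely, suppose stability fails. A noetherian argument (`isStableInter_of_forall`) yields a
homogeneous y t^d with y ∈ fM whose class modulo ft^sB(M) is killed by no power of some it. Choosing
such a class with maximal annihilator makes the annihilator a homogeneous prime
(`exists_isPrime_annihilator`), that is, a point x of the blowup. It is associated with the
restriction to (f)^#. It lies on E_I, because y = fm gives i^d y = f i^d m, so i^d kills the class
for each i ∈ I.

For the strict transform, an element ct^e of its ideal satisfies i^N c ∈ fR for each i ∈ I and some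
N. Hence (it)^N multiplies c·B(M) into fM, and stability puts the result, in large degrees, into
ft^sB(M). -/

theorem coe_reesMonomial {n : ℕ} {r : R} (hr : r ∈ I ^ n) :
    ((reesMonomial hr : reesAlgebra I) : R[X]) = monomial n r := rfl

theorem exists_eq_reesMonomial {n : ℕ} {p : reesAlgebra I} (hp : p ∈ reesGrading I n) :
    ∃ (r : R) (hr : r ∈ I ^ n), p = reesMonomial hr := by
  refine ⟨_, p.2 n, Subtype.ext (Polynomial.ext fun m => ?_)⟩
  rw [coe_reesMonomial, coeff_monomial]
  split_ifs with h
  · rw [h]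
  · exact hp m (Ne.symm h)

theorem pow_mem_ideal_pow {i : R} (hi : i ∈ I) (n : ℕ) : i ^ n ∈ I ^ n :=
  Ideal.pow_mem_pow hi n

theorem reesMonomial_mul {m n : ℕ} {r t : R} (hr : r ∈ I ^ m) (ht : t ∈ I ^ n) :
    reesMonomial hr * reesMonomial ht =
      reesMonomial (n := m + n) (r := r * t) (by rw [pow_add]; exact Ideal.mul_mem_mul hr ht) :=
  Subtype.ext (monomial_mul_monomial _ _ _ _)

theorem coe_decompose (p : reesAlgebra I) (n : ℕ) :
    (DirectSum.decompose (reesGrading I) p n : reesAlgebra I) = reesMonomial (p.2 n) := by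
  obtain ⟨r, hr, h⟩ := exists_eq_reesMonomial (DirectSum.decompose (reesGrading I) p n).2
  have h1 := coeff_coeAddMonoidHom I (DirectSum.decompose (reesGrading I) p) n
  have h2 : DirectSum.coeAddMonoidHom (reesGrading I) (DirectSum.decompose (reesGrading I) p) = p :=
    (DirectSum.decompose (reesGrading I)).symm_apply_apply p
  rw [h2, h, coe_reesMonomial, coeff_monomial_same] at h1
  rw [h]
  apply Subtype.ext
  rw [coe_reesMonomial, coe_reesMonomial, h1]

theorem mem_of_coeff_mem {𝔞 : Ideal (reesAlgebra I)} {p : reesAlgebra I}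
    (h : ∀ n, reesMonomial (p.2 n) ∈ 𝔞) : p ∈ 𝔞 := by
  classical
  rw [← DirectSum.sum_support_decompose (reesGrading I) p]
  exact sum_mem fun n _ => by rw [coe_decompose]; exact h n

theorem isHomogeneous_of_coeff {𝔞 : Ideal (reesAlgebra I)}
    (h : ∀ p ∈ 𝔞, ∀ n, reesMonomial (p.2 n) ∈ 𝔞) : 𝔞.IsHomogeneous (reesGrading I) :=
  fun n p hp => by
    rw [coe_decompose]
    exact h p hp n

theorem coeff_mem_of_isHomogeneous {𝔞 : Ideal (reesAlgebra I)}
    (h : 𝔞.IsHomogeneous (reesGrading I)) {p : reesAlgebra I} (hp : p ∈ 𝔞) (n : ℕ) :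
    reesMonomial (p.2 n) ∈ 𝔞 := by
  rw [← coe_decompose]
  exact h n hp

/-- The element `y t ^ n` of the Rees module, for `y ∈ I ^ n M`. -/
def reesModuleMonomial {n : ℕ} {y : M} (hy : y ∈ (I ^ n • ⊤ : Submodule R M)) :
    ReesModule I M :=
  ⟨PolynomialModule.single R n y, fun m => by
    change Finsupp.single n y m ∈ (I.stableFiltration (⊤ : Submodule R M)).N m
    rw [Finsupp.single_apply]
    split_ifs with h
    · subst h
      exact hy
    · exact zero_mem _⟩

theorem ReesModule.coeff_mem (p : ReesModule I M) (n : ℕ) :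
    p.1.coeff n ∈ (I ^ n • ⊤ : Submodule R M) := p.2 n

theorem ReesModule.ext_coeff {p q : ReesModule I M} (h : ∀ n, p.1.coeff n = q.1.coeff n) :
    p = q :=
  Subtype.ext (PolynomialModule.ext (Finsupp.ext h))

theorem coeff_reesModuleMonomial {n : ℕ} {y : M} (hy : y ∈ (I ^ n • ⊤ : Submodule R M)) (m : ℕ) :
    (reesModuleMonomial hy).1.coeff m = if n = m then y else 0 :=
  Finsupp.single_apply

theorem reesModuleMonomial_mem {n : ℕ} {y : M} (hy : y ∈ (I ^ n • ⊤ : Submodule R M)) :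
    reesModuleMonomial hy ∈ reesModuleGrading I M n := fun m hm => by
  rw [coeff_reesModuleMonomial, if_neg hm.symm]

theorem exists_eq_reesModuleMonomial {n : ℕ} {p : ReesModule I M}
    (hp : p ∈ reesModuleGrading I M n) :
    ∃ (y : M) (hy : y ∈ (I ^ n • ⊤ : Submodule R M)), p = reesModuleMonomial hy := by
  refine ⟨_, p.coeff_mem n, ReesModule.ext_coeff fun m => ?_⟩
  rw [coeff_reesModuleMonomial]
  split_ifs with h
  · rw [h]
  · exact hp m (Ne.symm h)

theorem mul_smul_mem {m n : ℕ} {r : R} {y : M} (hr : r ∈ I ^ m)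
    (hy : y ∈ (I ^ n • ⊤ : Submodule R M)) : r • y ∈ (I ^ (m + n) • ⊤ : Submodule R M) := by
  rw [pow_add, mul_smul]
  exact Submodule.smul_mem_smul hr hy

theorem reesMonomial_smul {m n : ℕ} {r : R} {y : M} (hr : r ∈ I ^ m)
    (hy : y ∈ (I ^ n • ⊤ : Submodule R M)) :
    reesMonomial hr • reesModuleMonomial hy = reesModuleMonomial (mul_smul_mem hr hy) :=
  Subtype.ext (PolynomialModule.monomial_smul_single _ _ _ _)

theorem coeff_smul_reesModuleMonomial (p : reesAlgebra I) {n : ℕ} {y : M}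
    (hy : y ∈ (I ^ n • ⊤ : Submodule R M)) (m : ℕ) :
    (p • reesModuleMonomial hy).1.coeff m = if n ≤ m then (p : R[X]).coeff (m - n) • y else 0 :=
  PolynomialModule.smul_single_apply _ _ _ _

theorem coeff_reesMonomial_smul {n : ℕ} {r : R} (hr : r ∈ I ^ n) (p : ReesModule I M) (m : ℕ) :
    (reesMonomial hr • p).1.coeff m = if n ≤ m then r • p.1.coeff (m - n) else 0 :=
  PolynomialModule.monomial_smul_apply _ _ _ _

theorem reesModuleMonomial_eq_zero_iff {n : ℕ} {y : M} (hy : y ∈ (I ^ n • ⊤ : Submodule R M)) :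
    reesModuleMonomial hy = 0 ↔ y = 0 := by
  constructor
  · intro h
    have := coeff_reesModuleMonomial hy n
    rw [if_pos rfl, h] at this
    exact this.symm
  · rintro rfl
    exact ReesModule.ext_coeff fun m => by rw [coeff_reesModuleMonomial, ite_self]; rfl

theorem ReesModule.map_reesModuleMonomial {M' : Type w} [AddCommGroup M'] [Module R M']
    (g : M →ₗ[R] M') {n : ℕ} {y : M} (hy : y ∈ (I ^ n • ⊤ : Submodule R M)) :
    ReesModule.map I g (reesModuleMonomial hy) =
      reesModuleMonomial (map_mem_pow_smul_top g (I ^ n) y hy) := by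
  refine ReesModule.ext_coeff fun m => ?_
  change g ((reesModuleMonomial hy).1.coeff m) = _
  rw [coeff_reesModuleMonomial, coeff_reesModuleMonomial]
  split_ifs
  · rfl
  · exact map_zero g

variable (M) in
/-- The submodule `f t ^ s B(M)` of the Rees module. -/
abbrev weakSubmodule {f : R} {s : ℕ} (hf : f ∈ I ^ s) :
    Submodule (reesAlgebra I) (ReesModule I M) :=
  reesMonomial hf • ⊤

theorem reesModuleMonomial_mem_weakSubmodule_iff {f : R} {s : ℕ} (hf : f ∈ I ^ s) {n : ℕ}
    (hn : s ≤ n) {y : M} (hy : y ∈ (I ^ n • ⊤ : Submodule R M)) :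
    reesModuleMonomial hy ∈ weakSubmodule M hf ↔
      y ∈ f • (I ^ (n - s) • ⊤ : Submodule R M) := by
  constructor
  · rintro ⟨p, -, hp⟩
    refine ⟨_, p.coeff_mem (n - s), ?_⟩
    have h := coeff_reesMonomial_smul hf p n
    rw [if_pos hn] at h
    refine h.symm.trans ?_
    have h' := coeff_reesModuleMonomial hy n
    rw [if_pos rfl] at h'
    refine Eq.trans ?_ h'
    exact congrArg (fun q : ReesModule I M => q.1.coeff n) hp
  · rintro ⟨z, hz, rfl⟩
    refine ⟨reesModuleMonomial hz, trivial, ?_⟩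
    refine (reesMonomial_smul hf hz).trans (ReesModule.ext_coeff fun m => ?_)
    rw [coeff_reesModuleMonomial, coeff_reesModuleMonomial, Nat.add_sub_cancel' hn]
    rfl

/-- Homogeneity of f t ^ s B(M). Together with the next lemma it makes the annihilator of a
homogeneous class modulo f t ^ s B(M) a homogeneous ideal, hence a candidate for a point of the
blowup. -/
theorem coeff_mem_weakSubmodule {f : R} {s : ℕ} (hf : f ∈ I ^ s) {p : ReesModule I M}
    (hp : p ∈ weakSubmodule M hf) (n : ℕ) :
    reesModuleMonomial (p.coeff_mem n) ∈ weakSubmodule M hf := by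
  obtain ⟨q, -, rfl⟩ := hp
  have h := coeff_reesMonomial_smul hf q n
  by_cases hn : s ≤ n
  · rw [reesModuleMonomial_mem_weakSubmodule_iff hf hn]
    rw [if_pos hn] at h
    exact ⟨_, q.coeff_mem _, h.symm⟩
  · rw [if_neg hn] at h
    have h0 := (reesModuleMonomial_eq_zero_iff ((reesMonomial hf • q).coeff_mem n)).2 h
    exact (congrArg (· ∈ weakSubmodule M hf) h0).mpr (zero_mem _)

theorem smul_mem_weakSubmodule_iff {f : R} {s : ℕ} (hf : f ∈ I ^ s) (p : reesAlgebra I) {n : ℕ}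
    {y : M} (hy : y ∈ (I ^ n • ⊤ : Submodule R M)) :
    p • reesModuleMonomial hy ∈ weakSubmodule M hf ↔
      ∀ m, reesMonomial (p.2 m) • reesModuleMonomial hy ∈ weakSubmodule M hf := by
  constructor
  · intro h m
    convert coeff_mem_weakSubmodule hf h (m + n) using 1
    rw [reesMonomial_smul]
    refine ReesModule.ext_coeff fun k => ?_
    rw [coeff_reesModuleMonomial, coeff_reesModuleMonomial, coeff_smul_reesModuleMonomial,
      if_pos (Nat.le_add_left n m), Nat.add_sub_cancel]
  · intro h
    classical
    rw [← DirectSum.sum_support_decompose (reesGrading I) p, Finset.sum_smul]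
    exact sum_mem fun m _ => by rw [coe_decompose]; exact h m

end Monomials

/-! ## Points of the blowup -/

section Points

variable {R : Type u} [CommRing R] {I : Ideal R}

theorem exists_coeff_notMem (x : Blowup I) {p : reesAlgebra I}
    (hp : p ∉ x.asHomogeneousIdeal.toIdeal) :
    ∃ n, reesMonomial (p.2 n) ∉ x.asHomogeneousIdeal.toIdeal := by
  by_contra! h
  exact hp (mem_of_coeff_mem h)

/-- The element `i t` of the Rees algebra. -/
def reesVar {i : R} (hi : i ∈ I) : reesAlgebra I :=
  reesMonomial (n := 1) (r := i) (by rwa [pow_one])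

theorem reesVar_mem {i : R} (hi : i ∈ I) : reesVar hi ∈ reesGrading I 1 :=
  reesMonomial_mem I _

theorem reesVar_pow {i : R} (hi : i ∈ I) (n : ℕ) :
    reesVar hi ^ n = reesMonomial (pow_mem_ideal_pow hi n) := by
  apply Subtype.ext
  change (monomial 1 i : R[X]) ^ n = monomial n (i ^ n)
  rw [monomial_pow, one_mul]

variable (I) in
/-- The ideal of the Rees algebra generated by the elements `i t` with `i ∈ I`. -/
def reesVarIdeal : Ideal (reesAlgebra I) :=
  Ideal.span (Set.range fun i : I => reesVar i.2)

theorem reesVarIdeal_le_iff {𝔞 : Ideal (reesAlgebra I)} :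
    reesVarIdeal I ≤ 𝔞 ↔ ∀ (i : R) (hi : i ∈ I), reesVar hi ∈ 𝔞 := by
  rw [reesVarIdeal, Ideal.span_le, Set.range_subset_iff]
  exact ⟨fun h i hi => h ⟨i, hi⟩, fun h i => h i.1 i.2⟩

/-- Since I ^ (n + 1) = I ^ n · I, every element of I ^ n t ^ n is a sum of products of n elements
of the form it. This turns a power of `reesVarIdeal` into a statement about all of I ^ N. -/
theorem reesMonomial_mem_reesVarIdeal_pow {n : ℕ} {r : R} (hr : r ∈ I ^ n) :
    reesMonomial hr ∈ reesVarIdeal I ^ n := by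
  induction n generalizing r with
  | zero => rw [pow_zero, Ideal.one_eq_top]; trivial
  | succ n ih =>
    have hr' := hr
    rw [pow_succ] at hr'
    induction hr' using Submodule.mul_induction_on' with
    | mem_mul_mem a ha b hb =>
      have := reesMonomial_mul ha (t := b) (n := 1) (by rwa [pow_one])
      rw [← this, pow_succ]
      exact Ideal.mul_mem_mul (ih ha) (reesVarIdeal_le_iff.1 le_rfl b hb)
    | add a ha b hb iha ihb =>
      rw [← pow_succ] at ha hb
      have : reesMonomial hr = reesMonomial ha + reesMonomial hb :=
        Subtype.ext (map_add (monomial (n + 1)) a b)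
      rw [this]
      exact add_mem (iha ha) (ihb hb)

/-- The charts D₊(it) cover the blowup, because the elements it generate the irrelevant ideal. The
chosen it serves everywhere below as a denominator that raises degrees at will. -/
theorem exists_reesVar_notMem (x : Blowup I) :
    ∃ (i : R) (hi : i ∈ I), reesVar hi ∉ x.asHomogeneousIdeal.toIdeal := by
  by_contra! h
  apply x.not_irrelevant_le
  rw [HomogeneousIdeal.irrelevant_le]
  intro n hn p hp
  obtain ⟨r, hr, rfl⟩ := exists_eq_reesMonomial hp
  obtain ⟨n, rfl⟩ := Nat.exists_eq_succ_of_ne_zero hn.ne'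
  exact (Ideal.pow_le_self n.succ_ne_zero).trans (reesVarIdeal_le_iff.2 h)
    (reesMonomial_mem_reesVarIdeal_pow hr)

theorem not_irrelevant_le_of_reesVar_notMem {𝔞 : HomogeneousIdeal (reesGrading I)} {i : R}
    (hi : i ∈ I) (h : reesVar hi ∉ 𝔞.toIdeal) :
    ¬ HomogeneousIdeal.irrelevant (reesGrading I) ≤ 𝔞 := fun hle =>
  h (hle (HomogeneousIdeal.mem_irrelevant_of_mem _ one_pos (reesVar_mem hi)))

theorem mem_exceptionalSupport_iff (x : Blowup I) : x ∈ exceptionalSupport I ↔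
    ∀ i ∈ I, algebraMap R (reesAlgebra I) i ∈ x.asHomogeneousIdeal.toIdeal := by
  exact Ideal.map_le_iff_le_comap

theorem reesMonomial_zero_eq {r : R} (hr : r ∈ I ^ 0) :
    reesMonomial hr = algebraMap R (reesAlgebra I) r :=
  rfl

end Points

/-! ## Stalks of `𝓑(M)` and of its restrictions -/

section Stalks

variable {R : Type u} [CommRing R] {I : Ideal R} {M : Type v} [AddCommGroup M] [Module R M]

theorem LocalizedModule.mk_eq_zero_iff {A : Type*} [CommRing A] {S : Submonoid A} {N : Type*}
    [AddCommGroup N] [Module A N] {n : N} {a : S} :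
    LocalizedModule.mk n a = 0 ↔ ∃ u : S, (u : A) • n = 0 := by
  rw [← LocalizedModule.zero_mk a, LocalizedModule.mk_eq]
  constructor
  · rintro ⟨u, hu⟩
    refine ⟨u * a, ?_⟩
    rw [smul_zero, smul_zero] at hu
    rw [Submonoid.coe_mul, mul_smul]
    exact hu
  · rintro ⟨u, hu⟩
    refine ⟨u, ?_⟩
    rw [smul_zero, smul_zero, smul_comm]
    change a • (u : A) • n = 0
    rw [hu, smul_zero]

/-- The element `y t ^ d / b t ^ d` of the stalk of `𝓑(M)`. -/
def SheafB.frac {x : Blowup I} {d : ℕ} {y : M} (hy : y ∈ (I ^ d • ⊤ : Submodule R M)) {b : R}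
    (hb : b ∈ I ^ d) (hbx : reesMonomial hb ∉ x.asHomogeneousIdeal.toIdeal) : SheafB I M x :=
  ⟨LocalizedModule.mk (reesModuleMonomial hy) ⟨reesMonomial hb, hbx⟩,
    d, _, _, reesModuleMonomial_mem hy, reesMonomial_mem I hb, rfl⟩

theorem SheafB.exists_eq_frac {x : Blowup I} (z : SheafB I M x) :
    ∃ (d : ℕ) (y : M) (hy : y ∈ (I ^ d • ⊤ : Submodule R M)) (b : R) (hb : b ∈ I ^ d)
      (hbx : reesMonomial hb ∉ x.asHomogeneousIdeal.toIdeal), z = SheafB.frac hy hb hbx := by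
  obtain ⟨_, d, n, ⟨a, hax⟩, hn, ha, rfl⟩ := z
  obtain ⟨y, hy, rfl⟩ := exists_eq_reesModuleMonomial hn
  obtain ⟨b, hb, rfl⟩ := exists_eq_reesMonomial ha
  exact ⟨d, y, hy, b, hb, hax, rfl⟩

/-- The element `c t ^ e / b t ^ e` of the local ring of the blowup. -/
def LocalRing.frac {x : Blowup I} {e : ℕ} {c b : R} (hc : c ∈ I ^ e) (hb : b ∈ I ^ e)
    (hbx : reesMonomial hb ∉ x.asHomogeneousIdeal.toIdeal) : LocalRing (reesGrading I) x :=
  HomogeneousLocalization.mk ⟨e, ⟨_, reesMonomial_mem I hc⟩, ⟨_, reesMonomial_mem I hb⟩, hbx⟩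

theorem LocalRing.exists_mk_eq_frac {x : Blowup I} (c : HomogeneousLocalization.NumDenSameDeg
    (reesGrading I) x.asHomogeneousIdeal.toIdeal.primeCompl) :
    ∃ (e : ℕ) (r : R) (hr : r ∈ I ^ e) (b : R) (hb : b ∈ I ^ e)
      (hbx : reesMonomial hb ∉ x.asHomogeneousIdeal.toIdeal),
      (c.num : reesAlgebra I) = reesMonomial hr ∧
      HomogeneousLocalization.mk c = LocalRing.frac hr hb hbx := by
  obtain ⟨e, ⟨n, hn⟩, ⟨a, ha⟩, hax⟩ := c
  obtain ⟨r, hr, rfl⟩ := exists_eq_reesMonomial hn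
  obtain ⟨b, hb, rfl⟩ := exists_eq_reesMonomial ha
  exact ⟨e, r, hr, b, hb, hax, rfl, rfl⟩

theorem reesMonomial_mul_notMem {x : Blowup I} {d e : ℕ} {b c : R} {hb : b ∈ I ^ d}
    {hc : c ∈ I ^ e} (hbx : reesMonomial hb ∉ x.asHomogeneousIdeal.toIdeal)
    (hcx : reesMonomial hc ∉ x.asHomogeneousIdeal.toIdeal) (h : b * c ∈ I ^ (d + e)) :
    reesMonomial h ∉ x.asHomogeneousIdeal.toIdeal := by
  have := x.asHomogeneousIdeal.toIdeal.primeCompl.mul_mem hbx hcx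
  rwa [reesMonomial_mul] at this

theorem LocalRing.frac_smul_frac {x : Blowup I} {d e : ℕ} {c b a : R} {y : M} (hc : c ∈ I ^ e)
    (hb : b ∈ I ^ e) (hbx : reesMonomial hb ∉ x.asHomogeneousIdeal.toIdeal)
    (hy : y ∈ (I ^ d • ⊤ : Submodule R M)) (ha : a ∈ I ^ d)
    (hax : reesMonomial ha ∉ x.asHomogeneousIdeal.toIdeal) (hba : b * a ∈ I ^ (e + d)) :
    LocalRing.frac hc hb hbx • SheafB.frac hy ha hax =
      SheafB.frac (mul_smul_mem hc hy) hba (reesMonomial_mul_notMem hbx hax hba) := by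
  apply SheafStalk.val_injective
  rw [SheafStalk.val_smul, LocalRing.frac, HomogeneousLocalization.val_mk]
  refine (LocalizedModule.mk_smul_mk _ _ _ _).trans ?_
  congr 1
  · exact reesMonomial_smul hc hy
  · exact Subtype.ext (reesMonomial_mul hb ha)

theorem SheafB.frac_eq_frac {x : Blowup I} {d e : ℕ} {y z : M} {a b : R}
    (hy : y ∈ (I ^ d • ⊤ : Submodule R M)) (ha : a ∈ I ^ d)
    (hax : reesMonomial ha ∉ x.asHomogeneousIdeal.toIdeal)
    (hz : z ∈ (I ^ e • ⊤ : Submodule R M)) (hb : b ∈ I ^ e)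
    (hbx : reesMonomial hb ∉ x.asHomogeneousIdeal.toIdeal) (h : b • y = a • z) :
    SheafB.frac hy ha hax = SheafB.frac hz hb hbx := by
  apply SheafStalk.val_injective
  refine LocalizedModule.mk_eq.2 ⟨1, ?_⟩
  rw [one_smul, one_smul]
  refine (reesMonomial_smul hb hy).trans ((reesMonomial_smul ha hz).trans ?_).symm
  refine ReesModule.ext_coeff fun m => ?_
  rw [coeff_reesModuleMonomial, coeff_reesModuleMonomial, h, add_comm d e]

theorem SheafB.frac_eq_zero_iff {x : Blowup I} {d : ℕ} {y : M}
    (hy : y ∈ (I ^ d • ⊤ : Submodule R M)) {a : R} (ha : a ∈ I ^ d)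
    (hax : reesMonomial ha ∉ x.asHomogeneousIdeal.toIdeal) :
    SheafB.frac hy ha hax = 0 ↔ ∃ (e : ℕ) (u : R) (hu : u ∈ I ^ e),
      reesMonomial hu ∉ x.asHomogeneousIdeal.toIdeal ∧ u • y = 0 := by
  have : SheafB.frac hy ha hax = 0 ↔ LocalizedModule.mk (reesModuleMonomial hy)
      (⟨reesMonomial ha, hax⟩ : x.asHomogeneousIdeal.toIdeal.primeCompl) = 0 :=
    (SheafStalk.val_injective _ _ x).eq_iff.symm
  rw [this, LocalizedModule.mk_eq_zero_iff]
  constructor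
  · rintro ⟨⟨u, hux⟩, hu⟩
    -- The multiplier can be made homogeneous: some coefficient of u lies outside x, and it kills y
    -- because y t ^ d is homogeneous.
    obtain ⟨e, he⟩ := exists_coeff_notMem x hux
    refine ⟨e, _, u.2 e, he, ?_⟩
    have h := coeff_smul_reesModuleMonomial u hy (e + d)
    rw [if_pos (Nat.le_add_left d e), Nat.add_sub_cancel] at h
    rw [← h]
    exact congrArg (fun q : ReesModule I M => q.1.coeff (e + d)) hu
  · rintro ⟨e, u, hu, hux, h⟩
    refine ⟨⟨_, hux⟩, ?_⟩
    refine (reesMonomial_smul hu hy).trans ?_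
    exact (reesModuleMonomial_eq_zero_iff _).2 h

theorem sheafBToQuot_frac (f : R) {x : Blowup I} {d : ℕ} {y : M}
    (hy : y ∈ (I ^ d • ⊤ : Submodule R M)) {a : R} (ha : a ∈ I ^ d)
    (hax : reesMonomial ha ∉ x.asHomogeneousIdeal.toIdeal) :
    sheafBToQuot M f x (SheafB.frac hy ha hax) = SheafB.frac
      (map_mem_pow_smul_top (f • (⊤ : Submodule R M)).mkQ (I ^ d) y hy) ha hax := by
  apply SheafStalk.val_injective
  refine (LocalizedModule.map_mk _ _ _ _).trans ?_
  rw [ReesModule.map_reesModuleMonomial]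
  rfl

theorem frac_mem_ker_sheafBToQuot_iff (f : R) {x : Blowup I} {d : ℕ} {y : M}
    (hy : y ∈ (I ^ d • ⊤ : Submodule R M)) {a : R} (ha : a ∈ I ^ d)
    (hax : reesMonomial ha ∉ x.asHomogeneousIdeal.toIdeal) :
    SheafB.frac hy ha hax ∈ LinearMap.ker (sheafBToQuot M f x) ↔
      ∃ (e : ℕ) (u : R) (hu : u ∈ I ^ e),
        reesMonomial hu ∉ x.asHomogeneousIdeal.toIdeal ∧ u • y ∈ f • (⊤ : Submodule R M) := by
  rw [LinearMap.mem_ker, sheafBToQuot_frac, SheafB.frac_eq_zero_iff]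
  simp only [Submodule.mkQ_apply, ← Submodule.Quotient.mk_smul, Submodule.Quotient.mk_eq_zero]

theorem idealStalk_smul_top_le {𝔞 : Ideal (reesAlgebra I)} {x : Blowup I}
    {P : Submodule (LocalRing (reesGrading I) x) (SheafB I M x)}
    (h : ∀ (d e : ℕ) (c b a : R) (y : M) (hc : c ∈ I ^ e) (_ : reesMonomial hc ∈ 𝔞) (hb : b ∈ I ^ e)
      (hbx : reesMonomial hb ∉ x.asHomogeneousIdeal.toIdeal)
      (hy : y ∈ (I ^ d • ⊤ : Submodule R M)) (ha : a ∈ I ^ d)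
      (hax : reesMonomial ha ∉ x.asHomogeneousIdeal.toIdeal) (hba : b * a ∈ I ^ (e + d)),
      SheafB.frac (mul_smul_mem hc hy) hba (reesMonomial_mul_notMem hbx hax hba) ∈ P) :
    idealStalk (reesGrading I) 𝔞 x •
      (⊤ : Submodule (LocalRing (reesGrading I) x) (SheafB I M x)) ≤ P := by
  refine Submodule.smul_le.2 fun r hr z _ => ?_
  refine (Submodule.span_le (p := P.comap
    (LinearMap.toSpanSingleton (LocalRing (reesGrading I) x) (SheafB I M x) z))).2 ?_ hr
  rintro _ ⟨q, hq, rfl⟩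
  obtain ⟨e, c, hc, b, hb, hbx, hqc, hqf⟩ := LocalRing.exists_mk_eq_frac q
  obtain ⟨d, y, hy, a, ha, hax, rfl⟩ := z.exists_eq_frac
  change HomogeneousLocalization.mk q • SheafB.frac hy ha hax ∈ P
  rw [hqf, LocalRing.frac_smul_frac hc hb hbx hy ha hax
    (by rw [pow_add]; exact Ideal.mul_mem_mul hb ha)]
  exact h _ _ _ _ _ _ hc (hqc ▸ hq) hb hbx hy ha hax _

variable (M) in
/-- The submodule of the stalk of `𝓑(M)` of all elements that vanish in the localization
of `B(M) / f t ^ s B(M)`. -/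
def weakKernel {f : R} {s : ℕ} (hf : f ∈ I ^ s) (x : Blowup I) :
    Submodule (LocalRing (reesGrading I) x) (SheafB I M x) where
  carrier := {z | LocalizedModule.map x.asHomogeneousIdeal.toIdeal.primeCompl
    (weakSubmodule M hf).mkQ z.val = 0}
  zero_mem' := map_zero (LocalizedModule.map x.asHomogeneousIdeal.toIdeal.primeCompl
    (weakSubmodule M hf).mkQ)
  add_mem' {y z} hy hz := by
    refine (map_add (LocalizedModule.map x.asHomogeneousIdeal.toIdeal.primeCompl
      (weakSubmodule M hf).mkQ) y.val z.val).trans ?_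
    rw [hy, hz, add_zero]
  smul_mem' r z hz := by
    refine (map_smul (LocalizedModule.map x.asHomogeneousIdeal.toIdeal.primeCompl
      (weakSubmodule M hf).mkQ) r.val z.val).trans ?_
    rw [hz, smul_zero]

theorem frac_mem_weakKernel_iff {f : R} {s : ℕ} (hf : f ∈ I ^ s) {x : Blowup I} {d : ℕ} {y : M}
    (hy : y ∈ (I ^ d • ⊤ : Submodule R M)) {a : R} (ha : a ∈ I ^ d)
    (hax : reesMonomial ha ∉ x.asHomogeneousIdeal.toIdeal) :
    SheafB.frac hy ha hax ∈ weakKernel M hf x ↔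
      ∃ u : reesAlgebra I, u ∉ x.asHomogeneousIdeal.toIdeal ∧
        u • reesModuleMonomial hy ∈ weakSubmodule M hf := by
  have : SheafB.frac hy ha hax ∈ weakKernel M hf x ↔
    LocalizedModule.mk ((weakSubmodule M hf).mkQ (reesModuleMonomial hy))
      (⟨reesMonomial ha, hax⟩ : x.asHomogeneousIdeal.toIdeal.primeCompl) = 0 := by
    rw [← LocalizedModule.map_mk x.asHomogeneousIdeal.toIdeal.primeCompl
      (weakSubmodule M hf).mkQ]
    exact Iff.rfl
  rw [this, LocalizedModule.mk_eq_zero_iff]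
  simp only [Submodule.mkQ_apply, ← Submodule.Quotient.mk_smul, Submodule.Quotient.mk_eq_zero]
  exact ⟨fun ⟨u, hu⟩ => ⟨u.1, u.2, hu⟩, fun ⟨u, hu, h⟩ => ⟨⟨u, hu⟩, h⟩⟩

theorem reesVar_pow_notMem {x : Blowup I} {i : R} {hi : i ∈ I}
    (hix : reesVar hi ∉ x.asHomogeneousIdeal.toIdeal) (n : ℕ) :
    reesMonomial (pow_mem_ideal_pow hi n) ∉ x.asHomogeneousIdeal.toIdeal := by
  rw [← reesVar_pow hi]
  exact fun h => hix (x.isPrime.mem_of_pow_mem n h)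

/-- Membership in the stalk of ft^s·𝓑(M) becomes a condition on elements of M. The clause s ≤ e + d
keeps the truncated subtraction e + d - s honest. -/
theorem frac_mem_weakStalk_smul_iff {f : R} {s : ℕ} (hf : f ∈ I ^ s) {x : Blowup I} {d : ℕ} {y : M}
    (hy : y ∈ (I ^ d • ⊤ : Submodule R M)) {a : R} (ha : a ∈ I ^ d)
    (hax : reesMonomial ha ∉ x.asHomogeneousIdeal.toIdeal) :
    SheafB.frac hy ha hax ∈ idealStalk (reesGrading I) (weakTransform hf) x •
        (⊤ : Submodule (LocalRing (reesGrading I) x) (SheafB I M x)) ↔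
      ∃ (e : ℕ) (u : R) (hu : u ∈ I ^ e), reesMonomial hu ∉ x.asHomogeneousIdeal.toIdeal ∧
        s ≤ e + d ∧ u • y ∈ f • (I ^ (e + d - s) • ⊤ : Submodule R M) := by
  obtain ⟨i, hi, hix⟩ := exists_reesVar_notMem x
  constructor
  · intro h
    -- Being a submodule, `weakKernel` absorbs sums, so only products of a generator with a fraction
    -- need checking.
    have key : idealStalk (reesGrading I) (weakTransform hf) x •
        (⊤ : Submodule (LocalRing (reesGrading I) x) (SheafB I M x)) ≤ weakKernel M hf x := by
      refine idealStalk_smul_top_le fun d e c b a y hc hcf hb hbx hy ha hax hba => ?_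
      rw [frac_mem_weakKernel_iff]
      refine ⟨1, x.asHomogeneousIdeal.toIdeal.primeCompl.one_mem, ?_⟩
      obtain ⟨r, hr⟩ := Ideal.mem_span_singleton'.1 hcf
      rw [one_smul, ← reesMonomial_smul hc hy, ← hr, mul_comm, mul_smul]
      exact Submodule.smul_mem_pointwise_smul _ _ _ trivial
    obtain ⟨u, hux, hu⟩ := (frac_mem_weakKernel_iff hf hy ha hax).1 (key h)
    obtain ⟨e, he⟩ := exists_coeff_notMem x hux
    -- The factor (it) ^ s lifts the degree to at least s, as the description of f t ^ s B(M) in a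
    -- given degree requires.
    have hmem : i ^ s * (u : R[X]).coeff e ∈ I ^ (s + e) := by
      rw [pow_add]
      exact Ideal.mul_mem_mul (pow_mem_ideal_pow hi s) (u.2 e)
    refine ⟨s + e, _, hmem, reesMonomial_mul_notMem (reesVar_pow_notMem hix s) he hmem,
      by omega, ?_⟩
    have h1 := (smul_mem_weakSubmodule_iff hf u hy).1 hu e
    replace h1 := (weakSubmodule M hf).smul_mem (reesMonomial (pow_mem_ideal_pow hi s)) h1
    rw [smul_smul, reesMonomial_mul, reesMonomial_smul,
      reesModuleMonomial_mem_weakSubmodule_iff hf (by omega)] at h1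
    exact h1
  · rintro ⟨e, u, hu, hux, hs, w, hw, h⟩
    replace h : f • w = u • y := h
    have hua : u * a ∈ I ^ (e + d) := by
      rw [pow_add]
      exact Ideal.mul_mem_mul hu ha
    have huax := reesMonomial_mul_notMem hux hax hua
    have hw' : i ^ s • w ∈ (I ^ (e + d) • ⊤ : Submodule R M) := by
      have := mul_smul_mem (pow_mem_ideal_pow hi s) hw
      rwa [Nat.add_sub_cancel' hs] at this
    have hba : i ^ s * (u * a) ∈ I ^ (s + (e + d)) := by
      rw [pow_add]
      exact Ideal.mul_mem_mul (pow_mem_ideal_pow hi s) hua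
    -- From f w = u y: y/a = (f/i^s) · (i^s w/(u a)), where the first factor lies in the stalk of
    -- the weak transform ideal.
    have heq : SheafB.frac hy ha hax = LocalRing.frac hf (pow_mem_ideal_pow hi s)
        (reesVar_pow_notMem hix s) • SheafB.frac hw' hua huax := by
      rw [LocalRing.frac_smul_frac _ _ _ _ _ _ hba]
      apply SheafB.frac_eq_frac
      rw [mul_smul, mul_smul, smul_comm f, h, smul_comm u a y, smul_comm a]
      simp only [smul_smul]
      ring_nf
    rw [heq]
    exact Submodule.smul_mem_smul (Ideal.subset_span ⟨_, Ideal.mem_span_singleton_self _, rfl⟩)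
      trivial

end Stalks

/-! ## Stability of the intersections `I ^ n M ∩ f M` -/

section Stability

variable {R : Type u} [CommRing R] {I : Ideal R} {M : Type v} [AddCommGroup M] [Module R M]

variable (I M) in
/-- The condition that `I ^ n M ∩ f M = f I ^ (n - s) M` for all large `n`. -/
def IsStableInter (f : R) (s : ℕ) : Prop :=
  ∃ n₀ ≥ s, ∀ n ≥ n₀, ∀ y ∈ (I ^ n • ⊤ : Submodule R M), y ∈ f • (⊤ : Submodule R M) →
    y ∈ f • (I ^ (n - s) • ⊤ : Submodule R M)

theorem smul_mem_smul_pow_smul_top {f r : R} {e n : ℕ} (hr : r ∈ I ^ e) {y : M}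
    (hy : y ∈ f • (I ^ n • ⊤ : Submodule R M)) :
    r • y ∈ f • (I ^ (e + n) • ⊤ : Submodule R M) := by
  obtain ⟨z, hz, rfl⟩ := hy
  refine ⟨r • z, mul_smul_mem hr hz, ?_⟩
  exact smul_comm f r z

theorem ideal_smul_smul_top_le (J : Ideal R) (f : R) :
    J • (f • (⊤ : Submodule R M)) ≤ f • (J • (⊤ : Submodule R M)) := by
  refine Submodule.smul_le.2 fun r hr _ => ?_
  rintro ⟨z, -, rfl⟩
  exact ⟨r • z, Submodule.smul_mem_smul hr trivial, smul_comm f r z⟩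

theorem mem_initialSmul_iff {f : R} {s : ℕ} (hf : f ∈ I ^ s) {n : ℕ} (hn : s ≤ n)
    (y : (I ^ n • ⊤ : Submodule R M)) :
    (Submodule.Quotient.mk y : Gr I M n) ∈ Gr.initialSmul M hf n ↔
      ∃ w ∈ f • (I ^ (n - s) • ⊤ : Submodule R M), (y : M) - w ∈ (I ^ (n + 1) • ⊤ : Submodule R M) := by
  -- For n ≥ s the supremum has the single term m = n - s.
  have h : Gr.initialSmul M hf n =
      LinearMap.range (Gr.mulInitial (M := M) hf (Nat.sub_add_cancel hn)) := by
    refine le_antisymm (iSup_le fun m => iSup_le fun h => ?_) (le_iSup₂_of_le _ _ le_rfl)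
    obtain rfl : m = n - s := by omega
    exact le_rfl
  rw [h]
  constructor
  · rintro ⟨z, hz⟩
    obtain ⟨z, rfl⟩ := Submodule.Quotient.mk_surjective _ z
    exact ⟨f • (z : M), ⟨z, z.2, rfl⟩, (Submodule.Quotient.eq
      ((I ^ (n + 1) • ⊤ : Submodule R M).submoduleOf (I ^ n • ⊤))).1 hz.symm⟩
  · rintro ⟨_, ⟨z, hz, rfl⟩, hw⟩
    exact ⟨Submodule.Quotient.mk ⟨z, hz⟩, ((Submodule.Quotient.eq
      ((I ^ (n + 1) • ⊤ : Submodule R M).submoduleOf (I ^ n • ⊤))).2 hw).symm⟩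

theorem mkQ_mem_ideal_smul_top_iff (J : Ideal R) (N : Submodule R M) (y : M) :
    N.mkQ y ∈ (J • ⊤ : Submodule R (M ⧸ N)) ↔
      ∃ z ∈ (J • ⊤ : Submodule R M), y - z ∈ N := by
  have h : (J • ⊤ : Submodule R (M ⧸ N)) = (J • ⊤ : Submodule R M).map N.mkQ := by
    rw [Submodule.map_smul'', Submodule.map_top, Submodule.range_mkQ]
  rw [h]
  constructor
  · rintro ⟨z, hz, hzy⟩
    exact ⟨z, hz, (Submodule.Quotient.eq N).1 hzy.symm⟩
  · rintro ⟨z, hz, hzy⟩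
    exact ⟨z, hz, ((Submodule.Quotient.eq N).2 hzy).symm⟩

theorem exists_lift_of_mem_ideal_smul_top (J : Ideal R) (N : Submodule R M) {y : M ⧸ N}
    (hy : y ∈ (J • ⊤ : Submodule R (M ⧸ N))) : ∃ z ∈ (J • ⊤ : Submodule R M), N.mkQ z = y := by
  obtain ⟨y, rfl⟩ := N.mkQ_surjective y
  obtain ⟨z, hz, h⟩ := (mkQ_mem_ideal_smul_top_iff J N y).1 hy
  exact ⟨z, hz, ((Submodule.Quotient.eq N).2 h).symm⟩

/-- Surjectivity is automatic. The kernel of G(M) → G(M/fM) in degree n consists of the classes of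
elements of I ^ n M ∩ fM, so injectivity is the inclusion of this intersection in f I ^ (n - s) M +
I ^ (n + 1) M. -/
theorem bijective_epi_iff {f : R} {s : ℕ} (hf : f ∈ I ^ s) {n : ℕ} (hn : s ≤ n) :
    Function.Bijective (Gr.epi M hf n) ↔
      ∀ y ∈ (I ^ n • ⊤ : Submodule R M), y ∈ f • (⊤ : Submodule R M) →
        ∃ w ∈ f • (I ^ (n - s) • ⊤ : Submodule R M), y - w ∈ (I ^ (n + 1) • ⊤ : Submodule R M) := by
  have hsurj : Function.Surjective (Gr.epi M hf n) := by
    intro z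
    obtain ⟨⟨z, hz⟩, rfl⟩ := Submodule.Quotient.mk_surjective _ z
    obtain ⟨y, hy, rfl⟩ := exists_lift_of_mem_ideal_smul_top _ _ hz
    exact ⟨Submodule.Quotient.mk (Submodule.Quotient.mk ⟨y, hy⟩), rfl⟩
  have hker : ∀ y : (I ^ n • ⊤ : Submodule R M),
      (Submodule.Quotient.mk y : Gr I M n) ∈
        LinearMap.ker (Gr.map (I := I) (f • (⊤ : Submodule R M)).mkQ n) ↔
      ∃ z ∈ (I ^ (n + 1) • ⊤ : Submodule R M), (y : M) - z ∈ f • (⊤ : Submodule R M) := by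
    intro y
    rw [← mkQ_mem_ideal_smul_top_iff, LinearMap.mem_ker]
    exact Submodule.Quotient.mk_eq_zero _
  have hinj : Function.Injective (Gr.epi M hf n) ↔
      LinearMap.ker (Gr.map (I := I) (f • (⊤ : Submodule R M)).mkQ n) ≤
        Gr.initialSmul M hf n := by
    rw [← LinearMap.ker_eq_bot, Gr.epi, Submodule.ker_liftQ, ← LinearMap.le_ker_iff_map,
      Submodule.ker_mkQ]
  rw [Function.Bijective, and_iff_left hsurj, hinj]
  constructor
  · intro h y hy hyf
    rw [← mem_initialSmul_iff hf hn ⟨y, hy⟩]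
    refine h ((hker ⟨y, hy⟩).2 ⟨0, zero_mem _, ?_⟩)
    rwa [sub_zero]
  · intro h z hz
    obtain ⟨y, rfl⟩ := Submodule.Quotient.mk_surjective _ z
    obtain ⟨z, hz, hyz⟩ := (hker y).1 hz
    have hz' : z ∈ (I ^ n • ⊤ : Submodule R M) :=
      Submodule.smul_mono_left (Ideal.pow_le_pow_right n.le_succ) hz
    -- Replacing y by y - z does not change its class and moves it into fM.
    obtain ⟨w, hw, hyw⟩ := h _ (sub_mem y.2 hz') hyz
    refine (mem_initialSmul_iff hf hn y).2 ⟨w, hw, ?_⟩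
    have := add_mem hyw hz
    rwa [sub_right_comm, sub_add_cancel] at this

theorem exists_bijective_epi_iff [IsNoetherianRing R] [Module.Finite R M] {f : R} {s : ℕ}
    (hf : f ∈ I ^ s) :
    (∃ n₀ : ℕ, ∀ n ≥ n₀, Function.Bijective (Gr.epi M hf n)) ↔ IsStableInter I M f s := by
  constructor
  · rintro ⟨n₀, h⟩
    refine ⟨max n₀ s, le_max_right _ _, fun n hn y hy hyf => ?_⟩
    -- Successive approximation: each error lies again in fM, in a higher power of I, and is
    -- corrected by an element of f I ^ (n + m - s) M ⊆ f I ^ (n - s) M.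
    have step : ∀ m, ∃ w ∈ f • (I ^ (n - s) • ⊤ : Submodule R M),
        y - w ∈ (I ^ (n + m) • ⊤ : Submodule R M) := by
      intro m
      induction m with
      | zero => exact ⟨0, zero_mem _, by rwa [sub_zero]⟩
      | succ m ih =>
        obtain ⟨w, hw, hyw⟩ := ih
        have hwf : w ∈ f • (⊤ : Submodule R M) :=
          Submodule.map_mono (f := DistribSMul.toLinearMap R M f) le_top hw
        obtain ⟨w', hw', hyw'⟩ := (bijective_epi_iff hf (n := n + m) (by omega)).1
          (h _ (by omega)) _ hyw (sub_mem hyf hwf)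
        refine ⟨w + w', add_mem hw ?_, by rwa [← sub_sub]⟩
        exact Submodule.map_mono (f := DistribSMul.toLinearMap R M f)
          (Submodule.smul_mono_left (Ideal.pow_le_pow_right (by omega))) hw'
    -- With the Artin–Rees constant k, k corrections suffice: the remaining error lies in I^(n+k) M
    -- ∩ fM = I^n (I^k M ∩ fM) ⊆ f I^n M.
    obtain ⟨k, hk⟩ := I.exists_pow_inf_eq_pow_smul (f • (⊤ : Submodule R M))
    obtain ⟨w, hw, hyw⟩ := step k
    have hwf : w ∈ f • (⊤ : Submodule R M) :=
      Submodule.map_mono (f := DistribSMul.toLinearMap R M f) le_top hw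
    have h1 : y - w ∈ (I ^ (n + k) • ⊤ ⊓ f • (⊤ : Submodule R M) : Submodule R M) :=
      ⟨hyw, sub_mem hyf hwf⟩
    rw [hk _ (Nat.le_add_left k n), Nat.add_sub_cancel] at h1
    have h2 : I ^ n • (I ^ k • ⊤ ⊓ f • (⊤ : Submodule R M)) ≤
        f • (I ^ (n - s) • ⊤ : Submodule R M) :=
      (Submodule.smul_mono (Ideal.pow_le_pow_right (Nat.sub_le n s)) inf_le_right).trans
        (ideal_smul_smul_top_le _ _)
    have := add_mem (h2 h1) hw
    rwa [sub_add_cancel] at this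
  · rintro ⟨n₀, hs, h⟩
    refine ⟨n₀, fun n hn => (bijective_epi_iff hf (hs.trans hn)).2 fun y hy hyf =>
      ⟨y, h n hn y hy hyf, ?_⟩⟩
    rw [sub_self]
    exact zero_mem _

/-- Each it is nilpotent on the class of y t ^ d modulo f t ^ s B(M). The Rees algebra is
noetherian, so the ideal generated by all it is finitely generated and one of its powers kills the
class. -/
theorem exists_forall_smul_mem_of_reesVar [IsNoetherianRing R] {f : R} {s : ℕ} (hf : f ∈ I ^ s)
    {d : ℕ} (hd : s ≤ d) {y : M} (hy : y ∈ (I ^ d • ⊤ : Submodule R M))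
    (h : ∀ i ∈ I, ∃ N : ℕ, i ^ N • y ∈ f • (I ^ (N + d - s) • ⊤ : Submodule R M)) :
    ∃ N : ℕ, ∀ u ∈ I ^ N, u • y ∈ f • (I ^ (N + d - s) • ⊤ : Submodule R M) := by
  set 𝔟 : Ideal (reesAlgebra I) := (weakSubmodule M hf).colon {reesModuleMonomial hy}
  have hmem : ∀ {n : ℕ} {u : R} (hu : u ∈ I ^ n), reesMonomial hu ∈ 𝔟 ↔
      u • y ∈ f • (I ^ (n + d - s) • ⊤ : Submodule R M) := by
    intro n u hu
    rw [Submodule.mem_colon_singleton, reesMonomial_smul,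
      reesModuleMonomial_mem_weakSubmodule_iff hf (by omega)]
  have hle : reesVarIdeal I ≤ 𝔟.radical := by
    rw [reesVarIdeal_le_iff]
    intro i hi
    obtain ⟨N, hN⟩ := h i hi
    refine ⟨N, ?_⟩
    rwa [reesVar_pow, hmem]
  obtain ⟨N, hN⟩ := Ideal.exists_pow_le_of_le_radical_of_fg hle (IsNoetherian.noetherian _)
  exact ⟨N, fun u hu => (hmem hu).1 (hN (reesMonomial_mem_reesVarIdeal_pow hu))⟩

/-- Reduces stability to one homogeneous element and one i ∈ I at a time; the two missing
uniformities come from noetherianity of the Rees algebra and of M. -/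
theorem isStableInter_of_forall [IsNoetherianRing R] [Module.Finite R M] {f : R} {s : ℕ}
    (hf : f ∈ I ^ s)
    (h : ∀ d ≥ s, ∀ y ∈ (I ^ d • ⊤ : Submodule R M), y ∈ f • (⊤ : Submodule R M) → ∀ i ∈ I,
      ∃ N : ℕ, i ^ N • y ∈ f • (I ^ (N + d - s) • ⊤ : Submodule R M)) :
    IsStableInter I M f s := by
  obtain ⟨k, hk⟩ := I.exists_pow_inf_eq_pow_smul (f • (⊤ : Submodule R M))
  obtain ⟨d, hsd, hkd⟩ : ∃ d, s ≤ d ∧ k ≤ d := ⟨max s k, le_max_left _ _, le_max_right _ _⟩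
  -- The elements of M carried by I ^ N into f I ^ (N + d - s) M form a chain increasing in N. Its
  -- stable value contains I ^ d M ∩ fM, which gives one N for all y.
  let Y : ℕ →o Submodule R M :=
    { toFun := fun N =>
        { carrier := {y | ∀ u ∈ I ^ N, u • y ∈ f • (I ^ (N + d - s) • ⊤ : Submodule R M)}
          zero_mem' := fun u _ => by rw [smul_zero]; exact zero_mem _
          add_mem' := fun ha hb u hu => by rw [smul_add]; exact add_mem (ha u hu) (hb u hu)
          smul_mem' := fun r a ha u hu => by
            rw [smul_comm u r a]
            exact Submodule.smul_mem _ r (ha u hu) }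
      monotone' := monotone_nat_of_le_succ fun N y hy u hu => by
        rw [pow_succ'] at hu
        induction hu using Submodule.mul_induction_on' with
        | mem_mul_mem a ha b hb =>
          have := smul_mem_smul_pow_smul_top (e := 1) (by rwa [pow_one]) (hy b hb) (r := a)
          rw [mul_smul]
          convert this using 4
          omega
        | add a _ b _ ha hb => rw [add_smul]; exact add_mem ha hb }
  obtain ⟨N, hN⟩ := monotone_stabilizes_iff_noetherian.2 (inferInstance : IsNoetherian R M) Y
  have hX : (I ^ d • ⊤ ⊓ f • (⊤ : Submodule R M) : Submodule R M) ≤ Y N := by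
    rintro y ⟨hy, hyf⟩
    obtain ⟨m, hm⟩ := exists_forall_smul_mem_of_reesVar hf hsd hy (h d hsd y hy hyf)
    have : y ∈ Y m := hm
    rw [hN (max N m) (le_max_left _ _)]
    exact Y.monotone (le_max_right N m) this
  refine ⟨N + d, by omega, fun n hn y hy hyf => ?_⟩
  have hy' : y ∈ (I ^ n • ⊤ ⊓ f • (⊤ : Submodule R M) : Submodule R M) := ⟨hy, hyf⟩
  -- As d and n are at least k, applying Artin–Rees twice gives I^n M ∩ fM = I^(n-d) (I^d M ∩ fM).
  rw [hk n (by omega), show n - k = (n - d) + (d - k) by omega, pow_add, mul_smul, ← hk d hkd] at hy'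
  have hle : I ^ (n - d) • (I ^ d • ⊤ ⊓ f • (⊤ : Submodule R M) : Submodule R M) ≤
      f • (I ^ (n - s) • ⊤ : Submodule R M) := by
    refine Submodule.smul_le.2 fun u hu z hz => ?_
    have h1 : z ∈ Y (n - d) := Y.monotone (show N ≤ n - d by omega) (hX hz)
    have h2 := h1 u hu
    rwa [Nat.sub_add_cancel (by omega)] at h2
  exact hle hy'

end Stability

/-! ## Homogeneous associated primes -/

section HomogeneousPrimes

/-- Let `S` be a set of elements with homogeneous annihilators that is stable under multiplication
by homogeneous elements. If no power of `a` kills some element of `S`, then some element of `S`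
has a prime annihilator that does not contain `a`. -/
theorem exists_isPrime_annihilator {A Q : Type*} [CommRing A] [IsNoetherianRing A] [AddCommGroup Q]
    [Module A Q] {σ : Type*} [SetLike σ A] [AddSubmonoidClass σ A] (𝒜 : ℕ → σ) [GradedRing 𝒜]
    {S : Set Q} (hS : ∀ k ∈ S, ∀ b : A, SetLike.IsHomogeneousElem 𝒜 b → b • k ∈ S)
    (hhom : ∀ k ∈ S, ((⊥ : Submodule A Q).colon {k}).IsHomogeneous 𝒜)
    {a : A} (ha : SetLike.IsHomogeneousElem 𝒜 a) {k₀ : Q} (hk₀ : k₀ ∈ S)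
    (hak₀ : ∀ n : ℕ, a ^ n • k₀ ≠ 0) :
    ∃ k ∈ S, ((⊥ : Submodule A Q).colon {k}).IsPrime ∧ a ∉ (⊥ : Submodule A Q).colon {k} := by
  obtain ⟨_, ⟨k, hk, hak, rfl⟩, hmax⟩ := set_has_maximal_iff_noetherian.2
    (inferInstance : IsNoetherianRing A)
    {J | ∃ k ∈ S, (∀ n : ℕ, a ^ n • k ≠ 0) ∧ J = (⊥ : Submodule A Q).colon {k}}
    ⟨_, k₀, hk₀, hak₀, rfl⟩
  -- If no power of a kills b • k, then b • k competes in the maximality; its annihilator contains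
  -- that of k, so the two agree.
  have heq : ∀ b : A, SetLike.IsHomogeneousElem 𝒜 b → (∀ n : ℕ, a ^ n • b • k ≠ 0) →
      ∀ c : A, c • b • k = 0 → c • k = 0 := by
    intro b hb hab c hc
    have hle : (⊥ : Submodule A Q).colon {k} ≤ (⊥ : Submodule A Q).colon {b • k} := by
      intro r hr
      rw [Submodule.mem_colon_singleton, Submodule.mem_bot] at hr ⊢
      rw [smul_comm, hr, smul_zero]
    have h1 := eq_of_le_of_not_lt hle (hmax _ ⟨b • k, hS k hk b hb, hab, rfl⟩)
    have h2 : c ∈ (⊥ : Submodule A Q).colon {b • k} := by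
      rwa [Submodule.mem_colon_singleton, Submodule.mem_bot]
    rwa [← h1, Submodule.mem_colon_singleton, Submodule.mem_bot] at h2
  -- The case b = a of the previous step: powers of a can be cancelled on multiples of k.
  have hcancel : ∀ (n : ℕ) (c : A), a ^ n • c • k = 0 → c • k = 0 := by
    intro n
    induction n with
    | zero => intro c h; rwa [pow_zero, one_smul] at h
    | succ n ih =>
      intro c h
      refine ih c ?_
      rw [smul_smul]
      refine heq a ha (fun m => ?_) _ ?_
      · rw [smul_smul, ← pow_succ]
        exact hak _
      · rw [pow_succ, mul_smul, smul_comm a c k] at h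
        rwa [mul_smul]
  -- Primality may be tested on homogeneous b and c. If c • k ≠ 0, cancellation shows that no power
  -- of a kills c • k, so b • c • k = 0 forces b • k = 0.
  refine ⟨k, hk, (hhom k hk).isPrime_of_homogeneous_mem_or_mem ?_ ?_, ?_⟩
  · rw [Ideal.ne_top_iff_one, Submodule.mem_colon_singleton, Submodule.mem_bot, one_smul]
    simpa using hak 0
  · intro b c hb hc hbc
    simp only [Submodule.mem_colon_singleton, Submodule.mem_bot] at hbc ⊢
    by_cases h : c • k = 0
    · exact Or.inr h
    · refine Or.inl (heq c hc (fun n hn => h (hcancel n c hn)) b ?_)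
      rwa [smul_smul]
  · rw [Submodule.mem_colon_singleton, Submodule.mem_bot]
    simpa using hak 1

end HomogeneousPrimes

/-! ## The canonical epimorphisms -/

section Epimorphisms

variable {R : Type u} [CommRing R] {I : Ideal R} {M : Type v} [AddCommGroup M] [Module R M]

theorem surjective_sheafBToQuot (f : R) (x : Blowup I) :
    Function.Surjective (sheafBToQuot M f x) := by
  intro z
  obtain ⟨d, y, hy, a, ha, hax, rfl⟩ := SheafB.exists_eq_frac z
  obtain ⟨y, hy', rfl⟩ := exists_lift_of_mem_ideal_smul_top _ _ hy
  exact ⟨SheafB.frac hy' ha hax, sheafBToQuot_frac f hy' ha hax⟩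

theorem bijective_weakToQuot_iff {f : R} {s : ℕ} (hf : f ∈ I ^ s) (x : Blowup I) :
    Function.Bijective (weakToQuot M hf x) ↔ LinearMap.ker (sheafBToQuot M f x) ≤
      idealStalk (reesGrading I) (weakTransform hf) x •
        (⊤ : Submodule (LocalRing (reesGrading I) x) (SheafB I M x)) := by
  have h1 : Function.Bijective (weakToQuot M hf x) ↔ Function.Bijective
      (Submodule.liftQ _ (sheafBToQuot M f x) (weak_smul_le_ker M hf x)) :=
    Function.Bijective.of_comp_iff _ (tensorQuotEquivQuotSMul (SheafB I M x)
      (idealStalk (reesGrading I) (weakTransform hf) x)).bijective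
  have hsurj : Function.Surjective
      (Submodule.liftQ _ (sheafBToQuot M f x) (weak_smul_le_ker M hf x)) := by
    intro z
    obtain ⟨z, rfl⟩ := surjective_sheafBToQuot f x z
    exact ⟨Submodule.Quotient.mk z, rfl⟩
  rw [h1, Function.Bijective, and_iff_left hsurj, ← LinearMap.ker_eq_bot, Submodule.ker_liftQ,
    ← LinearMap.le_ker_iff_map, Submodule.ker_mkQ]

theorem IsStableInter.bijective_weakToQuot {f : R} {s : ℕ} (hf : f ∈ I ^ s)
    (h : IsStableInter I M f s) (x : Blowup I) : Function.Bijective (weakToQuot M hf x) := by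
  rw [bijective_weakToQuot_iff]
  intro z hz
  obtain ⟨d, y, hy, a, ha, hax, rfl⟩ := z.exists_eq_frac
  obtain ⟨e, u, hu, hux, huy⟩ := (frac_mem_ker_sheafBToQuot_iff f hy ha hax).1 hz
  obtain ⟨i, hi, hix⟩ := exists_reesVar_notMem x
  obtain ⟨n, hsn, hn⟩ := h
  -- Multiplying by (it) ^ n reaches the stable range of degrees without leaving the complement of
  -- x.
  have hmem : i ^ n * u ∈ I ^ (n + e) := by
    rw [pow_add]
    exact Ideal.mul_mem_mul (pow_mem_ideal_pow hi n) hu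
  refine (frac_mem_weakStalk_smul_iff hf hy ha hax).2 ⟨n + e, _, hmem,
    reesMonomial_mul_notMem (reesVar_pow_notMem hix n) hux hmem, by omega, ?_⟩
  refine hn _ (by omega) _ (mul_smul_mem hmem hy) ?_
  rw [mul_smul]
  exact Submodule.smul_mem _ _ huy

/-! ## Associated points -/

theorem frac_mem_maximalIdeal_iff {x : Blowup I} {e : ℕ} {c b : R} (hc : c ∈ I ^ e)
    (hb : b ∈ I ^ e) (hbx : reesMonomial hb ∉ x.asHomogeneousIdeal.toIdeal) :
    LocalRing.frac hc hb hbx ∈ IsLocalRing.maximalIdeal (LocalRing (reesGrading I) x) ↔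
      reesMonomial hc ∈ x.asHomogeneousIdeal.toIdeal := by
  rw [IsLocalRing.mem_maximalIdeal, mem_nonunits_iff,
    ← HomogeneousLocalization.isUnit_iff_isUnit_val, LocalRing.frac,
    HomogeneousLocalization.val_mk, Localization.mk_eq_mk', IsLocalization.AtPrime.isUnit_mk'_iff]
  exact not_not

/-- On the chart D₊(it) the element i is a local equation of E_I, and it is a nonzerodivisor on
𝓑(M): if u i y = 0 with u t ^ e ∉ x, then (u i) t ^ (e + 1) = u t ^ e · it is also outside x and
kills y. The point is to read i in degree 1 instead of degree 0. -/
theorem eq_zero_of_frac_smul_eq_zero {x : Blowup I} {i : R} (hi : i ∈ I)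
    (hix : reesVar hi ∉ x.asHomogeneousIdeal.toIdeal) (hi0 : i ∈ I ^ 0) (h1 : (1 : R) ∈ I ^ 0)
    (h1x : reesMonomial h1 ∉ x.asHomogeneousIdeal.toIdeal) {z : SheafB I M x}
    (hz : LocalRing.frac hi0 h1 h1x • z = 0) : z = 0 := by
  obtain ⟨d, y, hy, a, ha, hax, rfl⟩ := z.exists_eq_frac
  rw [LocalRing.frac_smul_frac hi0 h1 h1x hy ha hax (by rwa [one_mul, zero_add]),
    SheafB.frac_eq_zero_iff] at hz
  obtain ⟨e, u, hu, hux, huy⟩ := hz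
  rw [SheafB.frac_eq_zero_iff]
  have hmem : u * i ∈ I ^ (e + 1) := by
    rw [pow_succ]
    exact Ideal.mul_mem_mul hu hi
  exact ⟨e + 1, u * i, hmem, reesMonomial_mul_notMem hux hix hmem, by rwa [mul_smul]⟩

theorem associatedPoints_inter_exceptionalSupport_of_bijective {f : R} {s : ℕ} (hf : f ∈ I ^ s)
    (h : ∀ x : Blowup I, Function.Bijective (weakToQuot M hf x)) :
    associatedPoints (reesGrading I) (RestrictB I M (weakTransform hf)) ∩
      exceptionalSupport I = ∅ := by
  rw [Set.eq_empty_iff_forall_notMem]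
  rintro x ⟨hx, hxE⟩
  replace hx : IsLocalRing.maximalIdeal (LocalRing (reesGrading I) x) ∈
      associatedPrimes (LocalRing (reesGrading I) x) (SheafB I (QuotSMulTop f M) x) := by
    rw [← LinearEquiv.AssociatedPrimes.eq (LinearEquiv.ofBijective (weakToQuot M hf x) (h x))]
    exact hx
  obtain ⟨hprime, z, hz⟩ := hx
  obtain ⟨i, hi, hix⟩ := exists_reesVar_notMem x
  have hi0 : i ∈ I ^ 0 := by rw [pow_zero, Ideal.one_eq_top]; trivial
  have h1 : (1 : R) ∈ I ^ 0 := by rw [pow_zero, Ideal.one_eq_top]; trivial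
  have h1x : reesMonomial h1 ∉ x.asHomogeneousIdeal.toIdeal :=
    x.asHomogeneousIdeal.toIdeal.primeCompl.one_mem
  have hmem : LocalRing.frac hi0 h1 h1x ∈
      IsLocalRing.maximalIdeal (LocalRing (reesGrading I) x) :=
    (frac_mem_maximalIdeal_iff hi0 h1 h1x).2 ((mem_exceptionalSupport_iff x).1 hxE i hi)
  rw [hz] at hmem
  -- The associated prime is the radical of an annihilator, so only a power of i/1 is known to kill
  -- z; injectivity is applied n times.
  obtain ⟨n, hn⟩ := hmem
  rw [Submodule.mem_colon_singleton, Submodule.mem_bot] at hn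
  have hz0 : z = 0 := by
    clear hz
    induction n with
    | zero => rwa [pow_zero, one_smul] at hn
    | succ n ih =>
      rw [pow_succ', mul_smul] at hn
      exact ih (eq_zero_of_frac_smul_eq_zero hi hix hi0 h1 h1x hn)
  apply hprime.ne_top
  rw [hz, Ideal.eq_top_iff_one]
  refine Ideal.le_radical ?_
  rw [Submodule.mem_colon_singleton, Submodule.mem_bot]
  exact (one_smul (LocalRing (reesGrading I) x) z).trans hz0

/-- The failure of stability produces a point x of Proj as the annihilator of a homogeneous class in
B(M)/ft^sB(M). Since it ∉ x for some i, the prime is relevant; the clause y ∈ fM will place x on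
E_I. -/
theorem exists_annihilator_of_not_isStableInter [IsNoetherianRing R] [Module.Finite R M] {f : R}
    {s : ℕ} (hf : f ∈ I ^ s) (h : ¬ IsStableInter I M f s) :
    ∃ (x : Blowup I) (d : ℕ) (y : M) (hy : y ∈ (I ^ d • ⊤ : Submodule R M)), s ≤ d ∧
      y ∈ f • (⊤ : Submodule R M) ∧ ∀ p : reesAlgebra I, p ∈ x.asHomogeneousIdeal.toIdeal ↔
        p • reesModuleMonomial hy ∈ weakSubmodule M hf := by
  have h0 : ∃ d ≥ s, ∃ y ∈ (I ^ d • ⊤ : Submodule R M), y ∈ f • (⊤ : Submodule R M) ∧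
      ∃ i ∈ I, ∀ N : ℕ, i ^ N • y ∉ f • (I ^ (N + d - s) • ⊤ : Submodule R M) := by
    by_contra! hcon
    exact h (isStableInter_of_forall hf hcon)
  obtain ⟨d₀, hd₀, y₀, hy₀, hyf₀, i, hi, hiN⟩ := h0
  let S : Set (ReesModule I M ⧸ weakSubmodule M hf) :=
    {k | ∃ (d : ℕ) (y : M) (hy : y ∈ (I ^ d • ⊤ : Submodule R M)), s ≤ d ∧
      y ∈ f • (⊤ : Submodule R M) ∧ k = (weakSubmodule M hf).mkQ (reesModuleMonomial hy)}
  have hcolon : ∀ {d : ℕ} {y : M} (hy : y ∈ (I ^ d • ⊤ : Submodule R M)) (p : reesAlgebra I),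
      p ∈ (⊥ : Submodule (reesAlgebra I) (ReesModule I M ⧸ weakSubmodule M hf)).colon
        {(weakSubmodule M hf).mkQ (reesModuleMonomial hy)} ↔
      p • reesModuleMonomial hy ∈ weakSubmodule M hf := by
    intro d y hy p
    rw [Submodule.mem_colon_singleton, Submodule.mem_bot, Submodule.mkQ_apply,
      ← Submodule.Quotient.mk_smul, Submodule.Quotient.mk_eq_zero]
  have hhom : ∀ k ∈ S, ((⊥ : Submodule (reesAlgebra I)
      (ReesModule I M ⧸ weakSubmodule M hf)).colon {k}).IsHomogeneous (reesGrading I) := by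
    rintro _ ⟨d, y, hy, -, -, rfl⟩
    refine isHomogeneous_of_coeff fun p hp n => ?_
    rw [hcolon] at hp ⊢
    exact (smul_mem_weakSubmodule_iff hf p hy).1 hp n
  obtain ⟨k, hkS, hprime, hik⟩ := exists_isPrime_annihilator (reesGrading I) (S := S)
    (by
      rintro _ ⟨d, y, hy, hd, hyf, rfl⟩ b ⟨e, hb⟩
      obtain ⟨r, hr, rfl⟩ := exists_eq_reesMonomial hb
      refine ⟨e + d, r • y, mul_smul_mem hr hy, by omega, Submodule.smul_mem _ _ hyf, ?_⟩
      rw [← map_smul, reesMonomial_smul])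
    hhom (a := reesVar hi) ⟨1, reesVar_mem hi⟩ (k₀ := (weakSubmodule M hf).mkQ
      (reesModuleMonomial hy₀)) ⟨d₀, y₀, hy₀, hd₀, hyf₀, rfl⟩
    (by
      intro N hN
      apply hiN N
      rw [reesVar_pow, ← map_smul, reesMonomial_smul, Submodule.mkQ_apply,
        Submodule.Quotient.mk_eq_zero, reesModuleMonomial_mem_weakSubmodule_iff hf (by omega)] at hN
      exact hN)
  have hhomk := hhom k hkS
  obtain ⟨d, y, hy, hd, hyf, rfl⟩ := hkS
  exact ⟨⟨⟨_, hhomk⟩, hprime, not_irrelevant_le_of_reesVar_notMem hi hik⟩, d, y, hy, hd, hyf,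
    hcolon hy⟩

theorem isStableInter_of_associatedPoints_inter [IsNoetherianRing R] [Module.Finite R M] {f : R}
    {s : ℕ} (hf : f ∈ I ^ s)
    (h : associatedPoints (reesGrading I) (RestrictB I M (weakTransform hf)) ∩
      exceptionalSupport I = ∅) : IsStableInter I M f s := by
  by_contra hcon
  obtain ⟨x, d, y, hy, hd, hyf, hx⟩ := exists_annihilator_of_not_isStableInter hf hcon
  have hx' : ∀ {n : ℕ} {u : R} (hu : u ∈ I ^ n),
      reesMonomial hu ∈ x.asHomogeneousIdeal.toIdeal ↔
        u • y ∈ f • (I ^ (n + d - s) • ⊤ : Submodule R M) := by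
    intro n u hu
    rw [hx, reesMonomial_smul, reesModuleMonomial_mem_weakSubmodule_iff hf (by omega)]
  refine Set.eq_empty_iff_forall_notMem.1 h x ⟨?_, ?_⟩
  · obtain ⟨i, hi, hix⟩ := exists_reesVar_notMem x
    change _ ∈ associatedPrimes _ _
    have hax := reesVar_pow_notMem hix d
    set J := idealStalk (reesGrading I) (weakTransform hf) x •
      (⊤ : Submodule (LocalRing (reesGrading I) x) (SheafB I M x)) with hJ
    have heq : associatedPrimes (LocalRing (reesGrading I) x) (RestrictB I M (weakTransform hf) x) =
        associatedPrimes (LocalRing (reesGrading I) x) (SheafB I M x ⧸ J) :=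
      LinearEquiv.AssociatedPrimes.eq (tensorQuotEquivQuotSMul (SheafB I M x)
        (idealStalk (reesGrading I) (weakTransform hf) x))
    rw [heq]
    -- The class y t ^ d, brought to degree zero by the denominator (it) ^ d, has the maximal ideal
    -- as its annihilator modulo J.
    set z : SheafB I M x := SheafB.frac hy (pow_mem_ideal_pow hi d) hax with hz
    have hcolon : ∀ r : LocalRing (reesGrading I) x,
        r ∈ (⊥ : Submodule (LocalRing (reesGrading I) x) (SheafB I M x ⧸ J)).colon
          {Submodule.Quotient.mk z} ↔ r • z ∈ J := by
      intro r
      rw [Submodule.mem_colon_singleton, Submodule.mem_bot, ← Submodule.Quotient.mk_smul,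
        Submodule.Quotient.mk_eq_zero]
    have hne : (⊥ : Submodule (LocalRing (reesGrading I) x) (SheafB I M x ⧸ J)).colon
        {Submodule.Quotient.mk z} ≠ ⊤ := by
      rw [Ideal.ne_top_iff_one, hcolon]
      intro h1z
      replace h1z : z ∈ J :=
        (congrArg (· ∈ J) (one_smul (LocalRing (reesGrading I) x) z)).mp h1z
      rw [hz, hJ, frac_mem_weakStalk_smul_iff] at h1z
      obtain ⟨e, u, hu, hux, -, huy⟩ := h1z
      exact hux ((hx' hu).2 huy)
    have hle : IsLocalRing.maximalIdeal (LocalRing (reesGrading I) x) ≤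
        (⊥ : Submodule (LocalRing (reesGrading I) x) (SheafB I M x ⧸ J)).colon
          {Submodule.Quotient.mk z} := by
      intro r hr
      obtain ⟨q, rfl⟩ := HomogeneousLocalization.mk_surjective r
      obtain ⟨e, c, hc, b, hb, hbx, -, hq⟩ := LocalRing.exists_mk_eq_frac q
      rw [hq, frac_mem_maximalIdeal_iff] at hr
      have h1 : (1 : R) ∈ I ^ 0 := by rw [pow_zero, Ideal.one_eq_top]; trivial
      rw [hcolon, hq, hz, LocalRing.frac_smul_frac hc hb hbx hy (pow_mem_ideal_pow hi d) hax
        (by rw [pow_add]; exact Ideal.mul_mem_mul hb (pow_mem_ideal_pow hi d)), hJ,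
        frac_mem_weakStalk_smul_iff]
      -- The numerator c t ^ e lies in x, so it kills the class before localization and the
      -- multiplier 1 suffices.
      refine ⟨0, 1, h1, x.asHomogeneousIdeal.toIdeal.primeCompl.one_mem, by omega, ?_⟩
      rw [one_smul, zero_add]
      exact (hx' hc).1 hr
    refine ⟨inferInstance, Submodule.Quotient.mk z, ?_⟩
    rw [← (IsLocalRing.maximalIdeal.isMaximal _).eq_of_le hne hle]
    exact (Ideal.IsPrime.radical inferInstance).symm
  · rw [mem_exceptionalSupport_iff]
    intro i hi
    -- Here i ^ d is read in degree 0: with y = f m, i ^ d y = f (i ^ d m) and i ^ d ∈ I ^ d ⊆ I ^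
    -- (d - s).
    have hid : i ^ d ∈ I ^ 0 := by rw [pow_zero, Ideal.one_eq_top]; trivial
    refine x.isPrime.mem_of_pow_mem d ?_
    rw [← map_pow, ← reesMonomial_zero_eq hid, hx']
    obtain ⟨m, -, rfl⟩ := hyf
    refine ⟨i ^ d • m, ?_, smul_comm f (i ^ d) m⟩
    refine Submodule.smul_mem_smul ?_ trivial
    exact Ideal.pow_le_pow_right (by omega) (pow_mem_ideal_pow hi d)

end Epimorphisms

/-! ## The strict transform -/

section StrictTransform

variable {R : Type u} [CommRing R] {I : Ideal R} {M : Type v} [AddCommGroup M] [Module R M]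

/-- The ideal of the Rees algebra of all polynomials with coefficients in `𝔭`. -/
def coeffIdeal (I 𝔭 : Ideal R) : Ideal (reesAlgebra I) :=
  (𝔭.map (C : R →+* R[X])).comap (reesAlgebra I).val

theorem mem_coeffIdeal_iff {𝔭 : Ideal R} {p : reesAlgebra I} :
    p ∈ coeffIdeal I 𝔭 ↔ ∀ n, (p : R[X]).coeff n ∈ 𝔭 :=
  Ideal.mem_map_C_iff

theorem reesMonomial_mem_coeffIdeal_iff {𝔭 : Ideal R} {n : ℕ} {r : R} (hr : r ∈ I ^ n) :
    reesMonomial hr ∈ coeffIdeal I 𝔭 ↔ r ∈ 𝔭 := by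
  rw [mem_coeffIdeal_iff, coe_reesMonomial]
  refine ⟨fun h => by simpa using h n, fun h m => ?_⟩
  rw [coeff_monomial]
  split_ifs
  · exact h
  · exact zero_mem _

/-- The point of the blowup outside the exceptional divisor over a prime ideal that does not
contain `i ∈ I`. -/
def Blowup.ofPrime (𝔭 : Ideal R) [h𝔭 : 𝔭.IsPrime] {i : R} (hi : i ∈ I) (hi𝔭 : i ∉ 𝔭) :
    Blowup I where
  asHomogeneousIdeal := ⟨coeffIdeal I 𝔭, isHomogeneous_of_coeff fun p hp n =>
    (reesMonomial_mem_coeffIdeal_iff _).2 (mem_coeffIdeal_iff.1 hp n)⟩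
  isPrime := by
    have : (𝔭.map (C : R →+* R[X])).IsPrime := Ideal.isPrime_map_C_of_isPrime
    exact Ideal.IsPrime.comap (K := 𝔭.map (C : R →+* R[X])) (reesAlgebra I).val
  not_irrelevant_le := not_irrelevant_le_of_reesVar_notMem hi fun h =>
    hi𝔭 ((reesMonomial_mem_coeffIdeal_iff _).1 h)

/-- Otherwise some prime 𝔭 containing ((f) : r) avoids the powers of i. At the point over 𝔭, which
is outside E_I, the inclusion of stalks gives a coefficient outside 𝔭 that multiplies r into (f), a
contradiction. -/
theorem exists_pow_mul_mem_span_of_idealStalk_le {f : R} {𝔞 : HomogeneousIdeal (reesGrading I)}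
    (h𝔞 : ∀ y ∉ exceptionalSupport I, idealStalk (reesGrading I) 𝔞.toIdeal y ≤
      idealStalk (reesGrading I) (totalTransform I f) y) {i : R} (hi : i ∈ I) {n : ℕ} {r : R}
    (hr : r ∈ I ^ n) (hr𝔞 : reesMonomial hr ∈ 𝔞.toIdeal) :
    ∃ N : ℕ, i ^ N * r ∈ Ideal.span {f} := by
  by_contra! hcon
  have hdisj : Disjoint (((Ideal.span {f}).colon {r} : Ideal R) : Set R)
      (Submonoid.powers i : Set R) := by
    rw [Set.disjoint_left]
    rintro _ hr' ⟨N, rfl⟩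
    exact hcon N (Submodule.mem_colon_singleton.1 hr')
  obtain ⟨𝔭, h𝔭, hle, hdisj⟩ := Ideal.exists_le_prime_disjoint _ _ hdisj
  have hi𝔭 : i ∉ 𝔭 := fun h => Set.disjoint_left.1 hdisj h (Submonoid.mem_powers i)
  let x : Blowup I := Blowup.ofPrime 𝔭 hi hi𝔭
  have hxE : x ∉ exceptionalSupport I := by
    rw [mem_exceptionalSupport_iff]
    intro h
    have hi0 : i ∈ I ^ 0 := by rw [pow_zero, Ideal.one_eq_top]; trivial
    have := h i hi
    rw [← reesMonomial_zero_eq hi0] at this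
    exact hi𝔭 ((reesMonomial_mem_coeffIdeal_iff _).1 this)
  have hix : reesVar hi ∉ x.asHomogeneousIdeal.toIdeal := fun h =>
    hi𝔭 ((reesMonomial_mem_coeffIdeal_iff _).1 h)
  have hmem := h𝔞 x hxE (Ideal.subset_span ⟨⟨n, ⟨_, reesMonomial_mem I hr⟩,
    ⟨_, reesMonomial_mem I (pow_mem_ideal_pow hi n)⟩, reesVar_pow_notMem hix n⟩, hr𝔞, rfl⟩)
  -- Passing to the full localization of B(R) at x turns the inclusion of stalks into u · r t ^ n ∈
  -- f B(R) for some u ∉ x.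
  have hle' : idealStalk (reesGrading I) (totalTransform I f) x ≤
      ((totalTransform I f).map (algebraMap (reesAlgebra I)
        (Localization.AtPrime x.asHomogeneousIdeal.toIdeal))).comap
      (algebraMap (LocalRing (reesGrading I) x)
        (Localization.AtPrime x.asHomogeneousIdeal.toIdeal)) := by
    refine Ideal.span_le.2 ?_
    rintro _ ⟨c, hc, rfl⟩
    change (HomogeneousLocalization.mk c).val ∈ (totalTransform I f).map (algebraMap _ _)
    rw [HomogeneousLocalization.val_mk, Localization.mk_eq_mk',
      IsLocalization.mk'_mem_map_algebraMap_iff]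
    exact ⟨1, one_mem _, by rwa [one_mul]⟩
  have hmem' := hle' hmem
  rw [Ideal.mem_comap] at hmem'
  change (HomogeneousLocalization.mk _).val ∈ (totalTransform I f).map (algebraMap _ _) at hmem'
  rw [HomogeneousLocalization.val_mk, Localization.mk_eq_mk',
    IsLocalization.mk'_mem_map_algebraMap_iff] at hmem'
  obtain ⟨u, hux, hu⟩ := hmem'
  obtain ⟨e, he⟩ := exists_coeff_notMem x hux
  obtain ⟨q, hq⟩ := Ideal.mem_span_singleton'.1 hu
  apply he
  refine (reesMonomial_mem_coeffIdeal_iff _).2 (hle (Submodule.mem_colon_singleton.2 ?_))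
  have h1 := congrArg (fun p : reesAlgebra I => (p : R[X]).coeff (e + n)) hq
  replace h1 : ((q : R[X]) * C f).coeff (e + n) = ((u : R[X]) * monomial n r).coeff (e + n) := h1
  rw [coeff_mul_C, coeff_mul_monomial] at h1
  rw [smul_eq_mul, ← h1]
  exact Ideal.mul_mem_left _ _ (Ideal.mem_span_singleton_self f)

/-- The ideal of all elements of the Rees algebra that are carried into `f R[t]` by a power
of `i`. -/
def saturationIdeal (I : Ideal R) (f i : R) : Ideal (reesAlgebra I) where
  carrier := {p | ∃ N : ℕ, algebraMap R (reesAlgebra I) i ^ N * p ∈ coeffIdeal I (Ideal.span {f})}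
  zero_mem' := ⟨0, by rw [mul_zero]; exact zero_mem _⟩
  add_mem' := by
    rintro p q ⟨N, hN⟩ ⟨K, hK⟩
    refine ⟨N + K, ?_⟩
    rw [mul_add]
    refine add_mem ?_ ?_
    · rw [pow_add, mul_comm (_ ^ N), mul_assoc]
      exact Ideal.mul_mem_left _ _ hN
    · rw [pow_add, mul_assoc]
      exact Ideal.mul_mem_left _ _ hK
  smul_mem' := by
    rintro q p ⟨N, hN⟩
    refine ⟨N, ?_⟩
    rw [smul_eq_mul, mul_left_comm]
    exact Ideal.mul_mem_left _ _ hN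

theorem reesMonomial_mem_saturationIdeal_iff {f i : R} {n : ℕ} {r : R} (hr : r ∈ I ^ n) :
    reesMonomial hr ∈ saturationIdeal I f i ↔ ∃ N : ℕ, i ^ N * r ∈ Ideal.span {f} := by
  refine exists_congr fun N => ?_
  have h : algebraMap R (reesAlgebra I) i ^ N * reesMonomial hr =
      reesMonomial (Ideal.mul_mem_left _ (i ^ N) hr) := by
    apply Subtype.ext
    change C i ^ N * monomial n r = monomial n (i ^ N * r)
    rw [← C_pow, C_mul_monomial]
  rw [h, reesMonomial_mem_coeffIdeal_iff]

theorem strictTransform_le_saturationIdeal (f : R) {i : R} (hi : i ∈ I) :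
    strictTransform I f ≤ saturationIdeal I f i := by
  rw [strictTransform, HomogeneousIdeal.toIdeal_sSup]
  refine iSup₂_le fun 𝔞 h𝔞 p hp => mem_of_coeff_mem fun n => ?_
  rw [reesMonomial_mem_saturationIdeal_iff]
  exact exists_pow_mul_mem_span_of_idealStalk_le h𝔞 hi _
    (coeff_mem_of_isHomogeneous 𝔞.isHomogeneous hp n)

/-- Both restrictions are quotients of the same stalk of 𝓑(M), so this inclusion is what injectivity
of `weakToStrict` requires. -/
theorem IsStableInter.strictStalk_smul_le {f : R} {s : ℕ} (hf : f ∈ I ^ s)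
    (h : IsStableInter I M f s) (x : Blowup I) :
    idealStalk (reesGrading I) (strictTransform I f) x •
        (⊤ : Submodule (LocalRing (reesGrading I) x) (SheafB I M x)) ≤
      idealStalk (reesGrading I) (weakTransform hf) x •
        (⊤ : Submodule (LocalRing (reesGrading I) x) (SheafB I M x)) := by
  obtain ⟨i, hi, hix⟩ := exists_reesVar_notMem x
  obtain ⟨n₀, hs, hn₀⟩ := h
  refine idealStalk_smul_top_le fun d e c b a y hc hcf hb hbx hy ha hax hba => ?_
  obtain ⟨N, hN⟩ := (reesMonomial_mem_saturationIdeal_iff hc).1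
    (strictTransform_le_saturationIdeal f hi hcf)
  rw [frac_mem_weakStalk_smul_iff]
  -- In the multiplier (it) ^ (n₀ + N), the factor i ^ N brings c y into fM and the factor (it) ^ n₀
  -- brings the degree into the stable range.
  refine ⟨n₀ + N, _, pow_mem_ideal_pow hi _, reesVar_pow_notMem hix _, by omega, ?_⟩
  refine hn₀ _ (by omega) _ (mul_smul_mem (pow_mem_ideal_pow hi _) (mul_smul_mem hc hy)) ?_
  obtain ⟨q, hq⟩ := Ideal.mem_span_singleton'.1 hN
  rw [pow_add, mul_smul]
  refine Submodule.smul_mem _ _ ?_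
  rw [smul_smul, ← hq, mul_comm, mul_smul]
  exact Submodule.smul_mem_pointwise_smul _ _ _ trivial

theorem IsStableInter.bijective_weakToStrict {f : R} {s : ℕ} (hf : f ∈ I ^ s)
    (h : IsStableInter I M f s) (x : Blowup I) : Function.Bijective (weakToStrict M hf x) := by
  refine ⟨(injective_iff_map_eq_zero _).2 fun t ht => ?_,
    LinearMap.lTensor_surjective _ (Submodule.factor_surjective _)⟩
  obtain ⟨z, rfl⟩ := (tensorQuotEquivQuotSMul (SheafB I M x)
    (idealStalk (reesGrading I) (weakTransform hf) x)).symm.surjective t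
  obtain ⟨z, rfl⟩ := Submodule.Quotient.mk_surjective _ z
  have h1 : (tensorQuotEquivQuotSMul (SheafB I M x)
      (idealStalk (reesGrading I) (strictTransform I f) x)).symm (Submodule.Quotient.mk z) = 0 := by
    rw [tensorQuotEquivQuotSMul_symm_mk] at ht ⊢
    exact ht
  rw [LinearEquiv.map_eq_zero_iff, Submodule.Quotient.mk_eq_zero] at h1
  rw [(Submodule.Quotient.mk_eq_zero _).2 (h.strictStalk_smul_le hf x h1)]
  exact map_zero _

end StrictTransform

end KirbySuperficial

end

theorem mainTheorem5 {R : Type*} [CommRing R] [IsNoetherianRing R] (I : Ideal R)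
    (M : Type*) [AddCommGroup M] [Module R M] [Module.Finite R M]
    (s : ℕ) (f : R) (hf : f ∈ I ^ s) (hf' : f ∉ I ^ (s + 1)) :
    ((∃ n₀ : ℕ, ∀ n ≥ n₀, Function.Bijective (KirbySuperficial.Gr.epi M hf n)) ↔
      KirbySuperficial.associatedPoints (KirbySuperficial.reesGrading I)
          (KirbySuperficial.RestrictB I M (KirbySuperficial.weakTransform hf)) ∩
        KirbySuperficial.exceptionalSupport I = ∅) ∧
    (KirbySuperficial.associatedPoints (KirbySuperficial.reesGrading I)
          (KirbySuperficial.RestrictB I M (KirbySuperficial.weakTransform hf)) ∩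
        KirbySuperficial.exceptionalSupport I = ∅ ↔
      ∀ x : KirbySuperficial.Blowup I,
        Function.Bijective (KirbySuperficial.weakToQuot M hf x)) ∧
    (KirbySuperficial.associatedPoints (KirbySuperficial.reesGrading I)
          (KirbySuperficial.RestrictB I M (KirbySuperficial.weakTransform hf)) ∩
        KirbySuperficial.exceptionalSupport I = ∅ →
      ∀ x : KirbySuperficial.Blowup I,
        Function.Bijective (KirbySuperficial.weakToStrict M hf x)) := by
  have h1 := KirbySuperficial.exists_bijective_epi_iff (M := M) hf
  have h2 := KirbySuperficial.isStableInter_of_associatedPoints_inter (M := M) hf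
  have h3 := KirbySuperficial.associatedPoints_inter_exceptionalSupport_of_bijective (M := M) hf
  have h4 := fun h => KirbySuperficial.IsStableInter.bijective_weakToQuot (M := M) hf h
  -- The cycle is: stability ⇒ isomorphism onto 𝓑(M/fM) ⇒ (**) ⇒ stability.
  exact ⟨h1.trans ⟨fun h => h3 (h4 h), h2⟩, ⟨fun h => h4 (h2 h), h3⟩,
    fun h => (h2 h).bijective_weakToStrict hf⟩
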